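/- Let $G=(V,E)$ be a finite undirected graph without self-loops or multiple edges, with $n=|V|$ vertices and maximum degree $D$. Let $\beta\in\mathbb R$, $B>0$, $p\in(0,1/2)$ and $h=n^{-p}$. For $f\in\mathbb C^V$ put $$N(f)=\sum_{x\in V}|f_x|^2,\qquad H(f)=\frac2n\sum_{\{x,y\}\in E}\Big|\frac{f_x-f_y}{h}\Big|^2-\frac1n\sum_{x\in V}|f_x|^4,$$ where each undirected edge is counted once, and let $M_1(f)$ and $M_2(f)$ be the largest and second largest components (with multiplicity) of $(|f_x|^2)_{x\in V}$. Let $\psi$ be a random element of $\mathbb C^V$ with law $$Z^{-1}e^{-\beta H(f)}1_{\{N(f)\le Bn\}}\prod_{x\in V}df_x ,$$ where $df_x$ is Lebesgue measure on $\mathbb C$ and $Z$ is the normalizing constant. Let $\theta_c$ be the unique zero in $[2,\infty)$ of $$m(\theta)=\frac\theta2-\frac12+\frac\theta2\sqrt{1-\frac2\theta}+\log\Big(\frac12-\frac12\sqrt{1-\frac2\theta}\Big),$$ and, when $\beta B^2\ge\theta_c$, let $a=\frac B2+\frac B2\sqrt{1-\frac{2}{\beta B^2}}$. (i) Suppose $\beta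 B^2>\theta_c$ and $\max\{2p,4/5\}<q<1$. Then there is a constant $C>0$ depending only on $\beta,B,D,p,q$ such that if $n>C$, then with probability at least $1-e^{-n^q/C}$, $$\Big|\frac{H(\psi)}n+a^2\Big|\le Cn^{-(1-q)/4},\quad \Big|\frac{N(\psi)}n-B\Big|\le Cn^{-(1-q)/2},\quad \Big|\frac{M_1(\psi)}n-a\Big|\le Cn^{-(1-q)/4},\quad \frac{M_2(\psi)}n\le Cn^{-(1-q)}.\tag{L}$$ (ii) Suppose $\beta B^2<\theta_c$ and $\max\{(1+2p)/2,17/18\}<q<1$. Then there is a constant $C>0$ depending only on $\beta,B,D,p,q$ such that if $n>C$, then with probability at least $1-e^{-n^q/C}$, $$\Big|\frac{H(\psi)}n\Big|\le 2n^{-2(1-q)},\quad \Big|\frac{N(\psi)}n-B\Big|\le n^{-(1-q)},\quad \frac{M_1(\psi)}n\le n^{-(1-q)}.\tag{D}$$ (iii) Suppose $\beta B^2=\theta_c$ and $\max\{(1+2p)/2,17/18\}<q<1$. Then there is a constant $C>0$ depending only on $\beta,B,D,p,q$ such that if $n>C$, then with probability at least $1-e^{-n^q/C}$ at least one of (L)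 (with this $C$) and (D) holds. -/

import Mathlib

universe u

namespace DNLS

/-- The function `m` on `[2, ∞)` whose zero is the critical parameter. -/
noncomputable def critFun (θ : ℝ) : ℝ :=
  θ / 2 - 1 / 2 + θ / 2 * √(1 - 2 / θ) + Real.log (1 / 2 - 1 / 2 * √(1 - 2 / θ))

/-- The function `m` has exactly one zero in `[2, ∞)`. -/
theorem existsUnique_critFun_zero : ∃! θ : ℝ, 2 ≤ θ ∧ critFun θ = 0 := by
  have hs : ∀ θ : ℝ, 2 ≤ θ → 0 ≤ 1 - 2 / θ ∧ 1 - 2 / θ < 1 := by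
    intro θ h
    have h0 : 0 < θ := by linarith
    have h1 : 2 / θ ≤ 1 := by rw [div_le_one h0]; exact h
    have h2 : 0 < 2 / θ := by positivity
    constructor <;> linarith
  have hs1 : ∀ θ : ℝ, 2 ≤ θ → √(1 - 2 / θ) < 1 := by
    intro θ h
    rw [Real.sqrt_lt' one_pos]
    simpa using (hs θ h).2
  let g : ℝ → ℝ := fun y => 1 / 2 * y⁻¹ - 1 / 2 + Real.log y
  have hg : StrictAntiOn g (Set.Ioc 0 (1 / 2)) := by
    have hd : ∀ y : ℝ, 0 < y → HasDerivAt g (1 / 2 * (-(y ^ 2)⁻¹) + y⁻¹) y := by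
      intro y hy
      have h1 := ((hasDerivAt_inv hy.ne').const_mul (1 / 2 : ℝ)).sub_const (1 / 2 : ℝ)
      exact h1.add (Real.hasDerivAt_log hy.ne')
    apply strictAntiOn_of_deriv_neg (convex_Ioc _ _)
    · intro y hy
      exact (hd y hy.1).continuousAt.continuousWithinAt
    · intro y hy
      rw [interior_Ioc] at hy
      rw [(hd y hy.1).deriv]
      have hy0 : 0 < y := hy.1
      have : 1 / 2 * (-(y ^ 2)⁻¹) + y⁻¹ = (2 * y - 1) / (2 * y ^ 2) := by
        field_simp; ring
      rw [this]
      apply div_neg_of_neg_of_pos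
      · have := hy.2; linarith
      · positivity
  have hm : ∀ θ : ℝ, 2 ≤ θ → critFun θ = g (1 / 2 - 1 / 2 * √(1 - 2 / θ)) := by
    intro θ h
    have h0 : 0 < θ := by linarith
    have hsq : √(1 - 2 / θ) ^ 2 = 1 - 2 / θ := Real.sq_sqrt (hs θ h).1
    have hlt := hs1 θ h
    simp only [critFun, g]
    generalize √(1 - 2 / θ) = s at *
    have hθ : θ * (1 - s ^ 2) = 2 := by
      rw [hsq]; field_simp; ring
    have h1 : (1 / 2 - 1 / 2 * s) ≠ 0 := by
      intro h'; linarith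
    have h2 : 1 / 2 * (1 / 2 - 1 / 2 * s)⁻¹ = θ / 2 + θ / 2 * s := by
      rw [mul_inv_eq_iff_eq_mul₀ h1]
      nlinarith
    rw [h2]; ring
  have hmem : ∀ θ : ℝ, 2 ≤ θ → 1 / 2 - 1 / 2 * √(1 - 2 / θ) ∈ Set.Ioc (0 : ℝ) (1 / 2) := by
    intro θ h
    have h1 := hs1 θ h
    have h2 := Real.sqrt_nonneg (1 - 2 / θ)
    constructor <;> linarith
  have hmono : StrictMonoOn critFun (Set.Ici 2) := by
    intro x hx y hy hxy
    rw [hm x hx, hm y hy]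
    apply hg (hmem y hy) (hmem x hx)
    have hx0 : (0 : ℝ) < x := lt_of_lt_of_le two_pos hx
    have h3 : √(1 - 2 / x) < √(1 - 2 / y) := by
      apply Real.sqrt_lt_sqrt (hs x hx).1
      have : 2 / y < 2 / x := div_lt_div_of_pos_left two_pos hx0 hxy
      linarith
    linarith
  have hcont : ContinuousOn critFun (Set.Icc 2 (25 / 8)) := by
    have hc : ContinuousOn (fun θ : ℝ => √(1 - 2 / θ)) (Set.Icc 2 (25 / 8)) := by
      apply ContinuousOn.sqrt
      apply continuousOn_const.sub
      apply continuousOn_const.div continuousOn_id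
      intro x hx
      have h1 : (2 : ℝ) ≤ x := hx.1
      have h0 : (0 : ℝ) < x := by linarith
      exact h0.ne'
    unfold critFun
    apply ContinuousOn.add
    · exact ((continuousOn_id.div_const 2).sub continuousOn_const).add
        ((continuousOn_id.div_const 2).mul hc)
    · apply ContinuousOn.log
      · exact continuousOn_const.sub (continuousOn_const.mul hc)
      · intro x hx
        exact (hmem x hx.1).1.ne'
  have hl2 := Real.log_two_gt_d9
  have hl2' := Real.log_two_lt_d9
  have h2 : critFun 2 < 0 := by
    have : critFun 2 = 1 / 2 - Real.log 2 := by
      have hz : (1 : ℝ) - 2 / 2 = 0 := by norm_num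
      have hlog : Real.log (1 / 2) = - Real.log 2 := by
        rw [one_div, Real.log_inv]
      simp only [critFun, hz, Real.sqrt_zero, mul_zero, sub_zero, hlog]
      ring
    rw [this]; linarith
  have h3 : 0 < critFun (25 / 8) := by
    have hsq : √((1 : ℝ) - 2 / (25 / 8)) = 3 / 5 := by
      rw [show (1 : ℝ) - 2 / (25 / 8) = (3 / 5) ^ 2 by norm_num]
      exact Real.sqrt_sq (by norm_num)
    have hlog : Real.log (1 / 5) = - (2 * Real.log 2 + Real.log (5 / 4)) := by
      rw [one_div, Real.log_inv, show (5 : ℝ) = 2 ^ 2 * (5 / 4) by norm_num,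
        Real.log_mul (by norm_num) (by norm_num), Real.log_pow]
      norm_num
    have h54 : Real.log (5 / 4) ≤ 5 / 4 - 1 := Real.log_le_sub_one_of_pos (by norm_num)
    have : critFun (25 / 8) = 2 + Real.log (1 / 5) := by
      simp only [critFun, hsq]
      norm_num
    rw [this, hlog]; linarith
  obtain ⟨θ, hθ, hθ0⟩ := intermediate_value_Icc (by norm_num : (2 : ℝ) ≤ 25 / 8) hcont
    (show (0 : ℝ) ∈ Set.Icc (critFun 2) (critFun (25 / 8)) from ⟨h2.le, h3.le⟩)
  refine ⟨θ, ⟨hθ.1, hθ0⟩, ?_⟩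
  rintro y ⟨hy, hy0⟩
  exact hmono.injOn hy hθ.1 (hy0.trans hθ0.symm)

/-- The critical parameter `θ_c`: the unique zero of `m` in `[2, ∞)`. -/
noncomputable def thetaC : ℝ := existsUnique_critFun_zero.choose

/-- The limiting mass fraction `a(β, B)` of the heaviest site, for `2 ≤ β * B ^ 2`. -/
noncomputable def condMass (β B : ℝ) : ℝ :=
  B / 2 + B / 2 * √(1 - 2 / (β * B ^ 2))

section Graph

variable {V : Type u} [Fintype V]

/-- The power `N(f) = ∑ |f_x|²`. -/
noncomputable def power (f : V → ℂ) : ℝ := ∑ x, ‖f x‖ ^ 2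

/-- The squared difference quotient `|(f_x - f_y) / h|²` along an unordered pair `{x, y}`. -/
noncomputable def gradSq (h : ℝ) (f : V → ℂ) : Sym2 V → ℝ :=
  Sym2.lift ⟨fun x y => ‖(f x - f y) / (h : ℂ)‖ ^ 2, fun x y => by
    beta_reduce
    rw [← neg_sub (f y) (f x), neg_div, norm_neg]⟩

/-- The Hamiltonian of the focusing cubic discrete NLS on `G` with lattice spacing `h`;
each undirected edge is counted once. -/
noncomputable def hamiltonian [DecidableEq V] (G : SimpleGraph V) [DecidableRel G.Adj]
    (h : ℝ) (f : V → ℂ) : ℝ :=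
  2 / (Fintype.card V : ℝ) * ∑ e ∈ G.edgeFinset, gradSq h f e
    - 1 / (Fintype.card V : ℝ) * ∑ x, ‖f x‖ ^ 4

/-- The unnormalised Gibbs measure `exp (-β H(f)) 1_{N(f) ≤ B n} df` on `ℂ^V`. -/
noncomputable def gibbsWeight [DecidableEq V] (G : SimpleGraph V) [DecidableRel G.Adj]
    (h β B : ℝ) : MeasureTheory.Measure (V → ℂ) :=
  (MeasureTheory.volume.restrict {f : V → ℂ | power f ≤ B * (Fintype.card V : ℝ)}).withDensity
    (fun f => ENNReal.ofReal (Real.exp (-β * hamiltonian G h f)))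

/-- The partition function `Z`. -/
noncomputable def partitionFn [DecidableEq V] (G : SimpleGraph V) [DecidableRel G.Adj]
    (h β B : ℝ) : ENNReal :=
  gibbsWeight G h β B Set.univ

/-- The Gibbs probability measure with mass cut-off: the law of the random map `ψ`. -/
noncomputable def gibbs [DecidableEq V] (G : SimpleGraph V) [DecidableRel G.Adj]
    (h β B : ℝ) : MeasureTheory.Measure (V → ℂ) :=
  (partitionFn G h β B)⁻¹ • gibbsWeight G h β B

/-- The largest component of `(|f_x|²)_{x ∈ V}`. -/
noncomputable def M₁ (f : V → ℂ) : ℝ := ⨆ x, ‖f x‖ ^ 2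

/-- The second largest component of `(|f_x|²)_{x ∈ V}`, counted with multiplicity: the largest
value on `V` with one site removed, the removed site being chosen so as to make this least
(that is, a site where the largest value is attained). It is `0` if `V` has one site. -/
noncomputable def M₂ (f : V → ℂ) : ℝ := ⨅ x, ⨆ y : {y : V // y ≠ x}, ‖f y‖ ^ 2

/-- The lattice spacing `h = n ^ (-p)`, where `n` is the number of sites. -/
noncomputable def spacing (V : Type u) [Fintype V] (p : ℝ) : ℝ := (Fintype.card V : ℝ) ^ (-p)

/-- The localised behaviour, with constant `C` in the rates. -/
def Localized [DecidableEq V] (G : SimpleGraph V) [DecidableRel G.Adj]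
    (h β B q C : ℝ) (f : V → ℂ) : Prop :=
  let n : ℝ := (Fintype.card V : ℝ)
  |hamiltonian G h f / n + condMass β B ^ 2| ≤ C * n ^ (-(1 - q) / 4) ∧
  |power f / n - B| ≤ C * n ^ (-(1 - q) / 2) ∧
  |M₁ f / n - condMass β B| ≤ C * n ^ (-(1 - q) / 4) ∧
  M₂ f / n ≤ C * n ^ (-(1 - q))

/-- The delocalised behaviour. -/
def Delocalized [DecidableEq V] (G : SimpleGraph V) [DecidableRel G.Adj]
    (h B q : ℝ) (f : V → ℂ) : Prop :=
  let n : ℝ := (Fintype.card V : ℝ)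
  |hamiltonian G h f / n| ≤ 2 * n ^ (-2 * (1 - q)) ∧
  |power f / n - B| ≤ n ^ (-(1 - q)) ∧
  M₁ f / n ≤ n ^ (-(1 - q))

end Graph

end DNLS

/-!
Write `X_x = |ψ_x|²` and `n = |V|`. On the support `∑ X_x ≤ B n` of the Gibbs measure the gradient
part of `H` is at most `4 D B n ^ (2 p)`, which is negligible against `n ^ q`; so up to a factor
`exp (o (n ^ q))` the weight is `exp (β S / n)` with `S = ∑ X_x²`, and the graph disappears.

Call a site big if `X_x > √n`, and let `m` and `Q` be the sums of `X_x` and `X_x²` over the big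
sites. The other sites contribute at most `B n √n` to `S`, and there are at most `B √n` big sites,
so that choosing them costs only `exp (O (√n log n))`. For a given set of `k` big sites, integrating
out the others gives the volume of a ball in `ℂ ^ (n - k)` of squared radius `B n - m`. With
`u = m / (B n)` and `θ = β B²` the weight, relative to the volume of the whole ball, is therefore
`exp (n (θ Q / (B n)² + log (1 - u)) + o (n ^ q))` (`lintegral_exp_quartic_le`). Since
`Q ≤ m²`, this is at most `exp (n rate θ u)` with `rate θ u = θ u² + log (1 - u)`. Let `g` be the
maximum of `rate θ`. Outside an event of probability `exp (-c n ^ q)`, each of the deficits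
`g - rate θ u`, `θ (u² - Q / (B n)²)` (mass spread over several big sites) and `B - N / n` is
`O (n ^ (q - 1))` (`gibbs_real_ge`), as soon as the partition function attains the exponent `n g`.
It does: for the maximum `0` at `u = 0`, because the upper bound at `β = 0` shows that half of the
ball has `S ≤ n ^ (2 q)` (`partitionFn_ge_spread`); for the maximum at `u = optFrac θ`, by putting
mass `a n` on one site (`partitionFn_ge_condensed`).

It remains to analyse `rate θ`. For `2 < θ` it is convex on `[0, 1/2]` and on `[1/2, 1)` it has a
nondegenerate maximum at `optFrac θ`, of value `critFun θ`. Hence the deficit is at least `c u` for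
`θ` below `thetaC`, at least `c (u - optFrac θ)²` above, and at least `c` times the smaller of `u`
and `(u - optFrac θ)²` at `thetaC`. A small `u` means that the configuration is delocalised, and `u`
near `optFrac θ` with `Q` near `m²` that a single site carries the mass `a n`.
-/

namespace DNLS

/-! ### The rate function -/

/-- The exponential rate, per site and relative to the volume of the ball, of putting the fraction
`u` of the total mass on one site, where `θ = β B²`. -/
noncomputable def rate (θ u : ℝ) : ℝ := θ * u ^ 2 + Real.log (1 - u)

/-- The larger critical point of `rate θ`, for `2 ≤ θ`. At `θ = β B²` it is
`condMass β B / B`. -/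
noncomputable def optFrac (θ : ℝ) : ℝ := 1 / 2 + 1 / 2 * √(1 - 2 / θ)

theorem optFrac_mul_one_sub {θ : ℝ} (hθ : 2 ≤ θ) :
    2 * θ * (optFrac θ * (1 - optFrac θ)) = 1 := by
  have h0 : 0 < θ := by linarith
  have h1 : 2 / θ ≤ 1 := by rw [div_le_one h0]; exact hθ
  have hs : √(1 - 2 / θ) ^ 2 = 1 - 2 / θ := Real.sq_sqrt (by linarith)
  have : optFrac θ * (1 - optFrac θ) = 1 / 4 * (1 - √(1 - 2 / θ) ^ 2) := by
    unfold optFrac; ring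
  rw [this, hs]
  field_simp
  ring

theorem half_lt_optFrac {θ : ℝ} (hθ : 2 < θ) : 1 / 2 < optFrac θ := by
  have h1 : 2 / θ < 1 := by rw [div_lt_one (by linarith)]; exact hθ
  have := Real.sqrt_pos.2 (sub_pos.2 h1)
  unfold optFrac
  linarith

theorem optFrac_lt_one {θ : ℝ} (hθ : 2 ≤ θ) : optFrac θ < 1 := by
  by_contra! h
  have h1 := optFrac_mul_one_sub hθ
  have : optFrac θ * (1 - optFrac θ) ≤ 0 :=
    mul_nonpos_of_nonneg_of_nonpos (by linarith) (by linarith)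
  nlinarith

theorem condMass_eq (β B : ℝ) : condMass β B = B * optFrac (β * B ^ 2) := by
  unfold condMass optFrac; ring

theorem rate_optFrac {θ : ℝ} (hθ : 2 ≤ θ) : rate θ (optFrac θ) = critFun θ := by
  have h := optFrac_mul_one_sub hθ
  have h1 : 1 - optFrac θ = 1 / 2 - 1 / 2 * √(1 - 2 / θ) := by unfold optFrac; ring
  have h2 : θ * optFrac θ ^ 2 = θ * optFrac θ - 1 / 2 := by linarith
  unfold rate critFun
  rw [h2, h1]
  unfold optFrac
  ring

theorem critFun_thetaC : critFun thetaC = 0 := existsUnique_critFun_zero.choose_spec.1.2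

theorem two_lt_thetaC : 2 < thetaC := by
  refine lt_of_le_of_ne existsUnique_critFun_zero.choose_spec.1.1 fun h => ?_
  have h0 := critFun_thetaC
  rw [← h] at h0
  have hz : (1 : ℝ) - 2 / 2 = 0 := by norm_num
  simp only [critFun, hz, Real.sqrt_zero, mul_zero, sub_zero, one_div, Real.log_inv] at h0
  linarith [Real.log_two_gt_d9]

/-- For `2 ≤ θ` the rate is convex on `[0, 1/2]`, hence below its chord from `rate θ 0 = 0`. -/
theorem rate_le_of_le_half {θ u : ℝ} (hθ : 2 ≤ θ) (h0 : 0 ≤ u) (h1 : u ≤ 1 / 2) :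
    rate θ u ≤ 2 * u * rate θ (1 / 2) := by
  have hd : ∀ x : ℝ, x < 1 → HasDerivAt (rate θ) (θ * (2 * x) - (1 - x)⁻¹) x := by
    intro x hx
    have e1 : HasDerivAt (fun y : ℝ => θ * y ^ 2) (θ * (2 * x)) x := by
      simpa using (hasDerivAt_pow 2 x).const_mul θ
    have e2 : HasDerivAt (fun y : ℝ => Real.log (1 - y)) (-1 / (1 - x)) x :=
      ((hasDerivAt_id x).const_sub 1).log (by simp only [id]; linarith)
    exact (e1.add e2).congr_deriv (by ring)
  have hc : ConvexOn ℝ (Set.Icc 0 (1 / 2)) (rate θ) := by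
    apply convexOn_of_hasDerivWithinAt2_nonneg (f' := fun x => θ * (2 * x) - (1 - x)⁻¹)
      (f'' := fun x => θ * 2 - ((1 - x) ^ 2)⁻¹) (convex_Icc _ _)
    · intro x hx
      exact (hd x (by linarith [hx.2])).continuousAt.continuousWithinAt
    · intro x hx
      rw [interior_Icc] at hx
      exact (hd x (by linarith [hx.2])).hasDerivWithinAt
    · intro x hx
      rw [interior_Icc] at hx
      have e0 : 1 - x ≠ 0 := by linarith [hx.2]
      have e1 : HasDerivAt (fun y : ℝ => θ * (2 * y)) (θ * 2) x := by
        simpa using ((hasDerivAt_id x).const_mul 2).const_mul θ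
      have e2 := ((hasDerivAt_id x).const_sub 1).inv e0
      exact ((e1.sub e2).congr_deriv (by simp)).hasDerivWithinAt
    · intro x hx
      rw [interior_Icc] at hx
      have : ((1 - x) ^ 2)⁻¹ ≤ 4 := by
        rw [inv_le_comm₀ (by nlinarith [hx.2]) (by norm_num)]
        nlinarith [hx.2]
      linarith
  have := hc.2 (show (0 : ℝ) ∈ Set.Icc 0 (1 / 2) by norm_num)
    (show (1 / 2 : ℝ) ∈ Set.Icc 0 (1 / 2) by norm_num)
    (show 0 ≤ 1 - 2 * u by linarith) (show 0 ≤ 2 * u by linarith) (by ring)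
  simp only [smul_eq_mul] at this
  have e : (1 - 2 * u) * 0 + 2 * u * (1 / 2) = u := by ring
  rw [e] at this
  simpa [rate] using this

/-- On `[1/2, 1)` the maximum of the rate at `optFrac θ` is quadratic: the derivative of
`rate θ x + θ (2 w - 1) (x - w)²`, where `w = optFrac θ`, is a nonnegative multiple of `w - x`. -/
theorem rate_le_of_half_le {θ u : ℝ} (hθ : 2 < θ) (h0 : 1 / 2 ≤ u) (h1 : u < 1) :
    rate θ u ≤ rate θ (optFrac θ) - θ * (2 * optFrac θ - 1) * (u - optFrac θ) ^ 2 := by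
  set w := optFrac θ with hw
  have hw0 : 1 / 2 < w := half_lt_optFrac hθ
  have hw1 : w < 1 := optFrac_lt_one hθ.le
  have hww : 2 * θ * (w * (1 - w)) = 1 := optFrac_mul_one_sub hθ.le
  set c := θ * (2 * w - 1) with hc
  let F : ℝ → ℝ := fun x => rate θ x + c * (x - w) ^ 2
  have hd : ∀ x : ℝ, x < 1 → HasDerivAt F
      (-(x - w) * (2 * θ * w * (2 * x - 1) / (1 - x))) x := by
    intro x hx
    have e1 : HasDerivAt (fun y : ℝ => θ * y ^ 2) (θ * (2 * x)) x := by
      simpa using (hasDerivAt_pow 2 x).const_mul θ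
    have e2 : HasDerivAt (fun y : ℝ => Real.log (1 - y)) (-1 / (1 - x)) x :=
      ((hasDerivAt_id x).const_sub 1).log (by simp only [id]; linarith)
    have e3 : HasDerivAt (fun y : ℝ => c * (y - w) ^ 2) (c * (2 * (x - w))) x := by
      simpa using (((hasDerivAt_id x).sub_const w).pow 2).const_mul c
    refine ((e1.add e2).add e3).congr_deriv ?_
    have e0 : 1 - x ≠ 0 := by linarith
    field_simp
    rw [hc]
    linear_combination hww
  have hpos : ∀ x : ℝ, 1 / 2 ≤ x → x < 1 → 0 ≤ 2 * θ * w * (2 * x - 1) / (1 - x) := by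
    intro x hx hx1
    have : 0 ≤ 2 * x - 1 := by linarith
    have : 0 < 1 - x := by linarith
    have : 0 < θ := by linarith
    positivity
  have hFw : F w = rate θ w := by simp [F]
  suffices F u ≤ F w by
    simp only [hFw] at this
    simp only [F] at this
    linarith
  rcases le_total u w with huw | huw
  · have hm : MonotoneOn F (Set.Icc (1 / 2) w) := by
      apply monotoneOn_of_deriv_nonneg (convex_Icc _ _)
      · intro x hx
        exact (hd x (by linarith [hx.2])).continuousAt.continuousWithinAt
      · intro x hx
        rw [interior_Icc] at hx
        exact (hd x (by linarith [hx.2])).differentiableAt.differentiableWithinAt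
      · intro x hx
        rw [interior_Icc] at hx
        rw [(hd x (by linarith [hx.2])).deriv]
        exact mul_nonneg (by linarith [hx.2]) (hpos x hx.1.le (by linarith [hx.2]))
    exact hm ⟨h0, huw⟩ ⟨hw0.le, le_rfl⟩ huw
  · have hm : AntitoneOn F (Set.Icc w u) := by
      apply antitoneOn_of_deriv_nonpos (convex_Icc _ _)
      · intro x hx
        exact (hd x (by linarith [hx.2])).continuousAt.continuousWithinAt
      · intro x hx
        rw [interior_Icc] at hx
        exact (hd x (by linarith [hx.2])).differentiableAt.differentiableWithinAt
      · intro x hx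
        rw [interior_Icc] at hx
        rw [(hd x (by linarith [hx.2])).deriv]
        exact mul_nonpos_of_nonpos_of_nonneg (by linarith [hx.1])
          (hpos x (by linarith [hx.1]) (by linarith [hx.2]))
    exact hm ⟨le_rfl, huw⟩ ⟨huw, le_rfl⟩ huw

theorem exists_rate_critical_le :
    ∃ c > 0, ∀ u, 0 ≤ u → u < 1 →
      rate thetaC u ≤ -(c * min u ((u - optFrac thetaC) ^ 2)) := by
  have h2 := two_lt_thetaC
  have hw := half_lt_optFrac h2
  have hr : rate thetaC (optFrac thetaC) = 0 := (rate_optFrac h2.le).trans critFun_thetaC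
  set w := optFrac thetaC
  have hc : 0 < thetaC * (2 * w - 1) := mul_pos (by linarith) (by linarith)
  have hneg : rate thetaC (1 / 2) < 0 := by
    have h := rate_le_of_half_le h2 le_rfl (by norm_num : (1 / 2 : ℝ) < 1)
    rw [hr] at h
    have : 0 < thetaC * (2 * w - 1) * (1 / 2 - w) ^ 2 :=
      mul_pos hc (by have : 1 / 2 - w ≠ 0 := by linarith
                     positivity)
    linarith
  refine ⟨min (thetaC * (2 * w - 1)) (-(2 * rate thetaC (1 / 2))),
    lt_min hc (by linarith), fun u h0 h1 => ?_⟩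
  rcases le_total u (1 / 2) with hu | hu
  · have h := rate_le_of_le_half h2.le h0 hu
    have : min (thetaC * (2 * w - 1)) (-(2 * rate thetaC (1 / 2))) * min u ((u - w) ^ 2)
        ≤ -(2 * rate thetaC (1 / 2)) * u :=
      mul_le_mul (min_le_right _ _) (min_le_left _ _) (le_min h0 (sq_nonneg _)) (by linarith)
    linarith
  · have h := rate_le_of_half_le h2 hu h1
    rw [hr] at h
    have : min (thetaC * (2 * w - 1)) (-(2 * rate thetaC (1 / 2))) * min u ((u - w) ^ 2)
        ≤ (thetaC * (2 * w - 1)) * (u - w) ^ 2 :=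
      mul_le_mul (min_le_left _ _) (min_le_right _ _) (le_min h0 (sq_nonneg _)) hc.le
    linarith

/-- Comparison with `thetaC`, where the rate is nonpositive; near `0` this gains only a quadratic
term, and `log (1 - u) ≤ -u` is used instead. -/
theorem exists_rate_subcritical_le {θ : ℝ} (hθ : θ < thetaC) :
    ∃ c > 0, ∀ u, 0 ≤ u → u < 1 → rate θ u ≤ -(c * u) := by
  obtain ⟨c, hc, h⟩ := exists_rate_critical_le
  have h2 := two_lt_thetaC
  have ht : 0 < thetaC := by linarith
  refine ⟨min (1 / 2) ((thetaC - θ) * (1 / (2 * thetaC))),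
    lt_min (by norm_num) (mul_pos (by linarith) (by positivity)), fun u h0 h1 => ?_⟩
  rcases le_total u (1 / (2 * thetaC)) with hu | hu
  · have hlog : Real.log (1 - u) ≤ (1 - u) - 1 := Real.log_le_sub_one_of_pos (by linarith)
    have e1 : thetaC * u ≤ 1 / 2 := by
      rw [le_div_iff₀ (by positivity)] at hu
      linarith
    have e2 : θ * u ^ 2 ≤ 1 / 2 * u := by nlinarith
    have e3 : min (1 / 2) ((thetaC - θ) * (1 / (2 * thetaC))) * u ≤ 1 / 2 * u :=
      mul_le_mul_of_nonneg_right (min_le_left _ _) h0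
    unfold rate
    linarith
  · have hle := h u h0 h1
    have e0 : 0 ≤ c * min u ((u - optFrac thetaC) ^ 2) :=
      mul_nonneg hc.le (le_min h0 (sq_nonneg _))
    have e1 : rate θ u = rate thetaC u - (thetaC - θ) * u ^ 2 := by unfold rate; ring
    have e2 : min (1 / 2) ((thetaC - θ) * (1 / (2 * thetaC))) * u ≤
        (thetaC - θ) * (1 / (2 * thetaC)) * u :=
      mul_le_mul_of_nonneg_right (min_le_right _ _) h0
    have e3 : (thetaC - θ) * (1 / (2 * thetaC)) * u ≤ (thetaC - θ) * u ^ 2 := by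
      rw [mul_assoc, pow_two]
      exact mul_le_mul_of_nonneg_left (mul_le_mul_of_nonneg_right hu h0) (by linarith)
    linarith

/-- Above `thetaC` the maximum of the rate is positive. On `[0, 1/2]` the rate is at most
`max 0 (rate θ (1 / 2))`, so there the quadratic bound holds after decreasing the constant. -/
theorem exists_rate_supercritical_le {θ : ℝ} (hθ : thetaC < θ) :
    0 < rate θ (optFrac θ) ∧ ∃ c > 0, ∀ u, 0 ≤ u → u < 1 →
      rate θ u ≤ rate θ (optFrac θ) - c * (u - optFrac θ) ^ 2 := by
  have h2 : 2 < θ := two_lt_thetaC.trans hθ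
  have hw := half_lt_optFrac h2
  have hw1 := optFrac_lt_one h2.le
  set w := optFrac θ
  have hc : 0 < θ * (2 * w - 1) := mul_pos (by linarith) (by linarith)
  have hpos : 0 < rate θ w := by
    have hr : rate thetaC (optFrac thetaC) = 0 :=
      (rate_optFrac two_lt_thetaC.le).trans critFun_thetaC
    have hv := half_lt_optFrac two_lt_thetaC
    set v := optFrac thetaC
    have h := rate_le_of_half_le h2 hv.le (optFrac_lt_one two_lt_thetaC.le)
    have e1 : rate θ v = rate thetaC v + (θ - thetaC) * v ^ 2 := by unfold rate; ring
    have e2 : 0 < (θ - thetaC) * v ^ 2 := mul_pos (by linarith) (by positivity)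
    have e3 : 0 ≤ θ * (2 * w - 1) * (v - w) ^ 2 := mul_nonneg hc.le (sq_nonneg _)
    linarith
  have hhalf : rate θ (1 / 2) < rate θ w := by
    have h := rate_le_of_half_le h2 le_rfl (by norm_num : (1 / 2 : ℝ) < 1)
    have : 0 < θ * (2 * w - 1) * (1 / 2 - w) ^ 2 :=
      mul_pos hc (by have : 1 / 2 - w ≠ 0 := by linarith
                     positivity)
    linarith
  refine ⟨hpos, min (θ * (2 * w - 1)) (rate θ w - max 0 (rate θ (1 / 2))),
    lt_min hc (sub_pos.2 (max_lt hpos hhalf)), fun u h0 h1 => ?_⟩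
  rcases le_total u (1 / 2) with hu | hu
  · have h := rate_le_of_le_half h2.le h0 hu
    have e0 : 2 * u * rate θ (1 / 2) ≤ max 0 (rate θ (1 / 2)) := by
      have hm := le_max_right 0 (rate θ (1 / 2))
      have hm0 := le_max_left 0 (rate θ (1 / 2))
      calc 2 * u * rate θ (1 / 2) ≤ 2 * u * max 0 (rate θ (1 / 2)) :=
            mul_le_mul_of_nonneg_left hm (by linarith)
        _ ≤ 1 * max 0 (rate θ (1 / 2)) := mul_le_mul_of_nonneg_right (by linarith) hm0
        _ = _ := one_mul _
    have e1 : min (θ * (2 * w - 1)) (rate θ w - max 0 (rate θ (1 / 2))) * (u - w) ^ 2 ≤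
        (rate θ w - max 0 (rate θ (1 / 2))) * 1 :=
      mul_le_mul (min_le_right _ _) (by nlinarith) (sq_nonneg _)
        (sub_pos.2 (max_lt hpos hhalf)).le
    linarith
  · have h := rate_le_of_half_le h2 hu h1
    have e1 : min (θ * (2 * w - 1)) (rate θ w - max 0 (rate θ (1 / 2))) * (u - w) ^ 2 ≤
        θ * (2 * w - 1) * (u - w) ^ 2 :=
      mul_le_mul_of_nonneg_right (min_le_left _ _) (sq_nonneg _)
    linarith

open MeasureTheory Filter Asymptotics

/-! ### Volumes of balls and their slices -/

section Volume

/-- The volume of `{f ∈ ℂ ^ k | ∑ |f_i|² ≤ R}`, for `0 ≤ R`; note that `R` is the squared radius. -/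
noncomputable def ballVolume (k : ℕ) (R : ℝ) : ℝ := (Real.pi * R) ^ k / k.factorial

theorem ballVolume_nonneg (k : ℕ) {R : ℝ} (hR : 0 ≤ R) : 0 ≤ ballVolume k R := by
  have := Real.pi_pos
  unfold ballVolume
  positivity

theorem ballVolume_pos (k : ℕ) {R : ℝ} (hR : 0 < R) : 0 < ballVolume k R := by
  have := Real.pi_pos
  unfold ballVolume
  positivity

theorem measurable_power {ι : Type*} [Fintype ι] : Measurable (power : (ι → ℂ) → ℝ) := by
  unfold power
  fun_prop

theorem power_nonneg {ι : Type*} [Fintype ι] (f : ι → ℂ) : 0 ≤ power f :=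
  Finset.sum_nonneg fun _ _ => by positivity

theorem volume_power_le (ι : Type*) [Fintype ι] {R : ℝ} (hR : 0 ≤ R) :
    volume {f : ι → ℂ | power f ≤ R} = ENNReal.ofReal (ballVolume (Fintype.card ι) R) := by
  rcases isEmpty_or_nonempty ι with h | h
  · have : {f : ι → ℂ | power f ≤ R} = Set.univ := by
      ext f; simp [power, hR]
    rw [this, volume_pi, Measure.pi_univ]
    simp [ballVolume]
  · have h := Complex.volume_sum_rpow_le ι (p := 2) (by norm_num) (√R)
    have e : {x : ι → ℂ | (∑ i, ‖x i‖ ^ (2 : ℝ)) ^ (1 / (2 : ℝ)) ≤ √R} =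
        {f : ι → ℂ | power f ≤ R} := by
      ext f
      simp only [Set.mem_ofPred_eq, ← Real.sqrt_eq_rpow, power]
      rw [Real.sqrt_le_sqrt_iff hR]
      norm_cast
    rw [e] at h
    rw [h, ← ENNReal.ofReal_pow (Real.sqrt_nonneg R),
      ← ENNReal.ofReal_mul (by positivity), pow_mul, Real.sq_sqrt hR]
    congr 1
    have e1 : (2 : ℝ) * (Fintype.card ι : ℝ) / 2 + 1 = (Fintype.card ι : ℝ) + 1 := by ring
    have e2 : (2 : ℝ) / 2 + 1 = 1 + 1 := by norm_num
    rw [e1, Real.Gamma_nat_eq_factorial, e2, Real.Gamma_add_one one_ne_zero, Real.Gamma_one,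
      ballVolume, mul_pow]
    ring

variable {V : Type*} [Fintype V]

theorem power_split (P : V → Prop) [DecidablePred P] (f : V → ℂ) :
    power f = power (fun x : {x // P x} => f x) + power (fun x : {x // ¬P x} => f x) :=
  (Fintype.sum_subtype_add_sum_subtype P (fun x => ‖f x‖ ^ 2)).symm

/-- Integrating, over the ball `power f ≤ R`, the inverse of the volume (up to a constant) of the
slice through `f` along the coordinates outside `P` gives the volume of the projection of the ball
onto the coordinates in `P`. -/
theorem lintegral_inv_slice_le (P : V → Prop) [DecidablePred P] {R : ℝ} (hR : 0 ≤ R) :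
    ∫⁻ f in {f : V → ℂ | power f ≤ R},
        (ENNReal.ofReal ((R - power fun x : {x // P x} => f x) ^ Fintype.card {x // ¬P x}))⁻¹ ≤
      ENNReal.ofReal (ballVolume (Fintype.card {x // P x}) R *
        (Real.pi ^ Fintype.card {x // ¬P x} / (Fintype.card {x // ¬P x}).factorial)) := by
  set j := Fintype.card {x // ¬P x} with hj
  have hpi := Real.pi_pos
  let G : ({x // P x} → ℂ) × ({x // ¬P x} → ℂ) → ENNReal := fun z =>
    {z : ({x // P x} → ℂ) × ({x // ¬P x} → ℂ) | power z.1 + power z.2 ≤ R}.indicator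
      (fun z => (ENNReal.ofReal ((R - power z.1) ^ j))⁻¹) z
  have hms : MeasurableSet {f : V → ℂ | power f ≤ R} :=
    measurableSet_le measurable_power measurable_const
  have hmp := volume_preserving_piEquivPiSubtypeProd (fun _ : V => ℂ) P
  have h1 : ∫⁻ f in {f : V → ℂ | power f ≤ R},
        (ENNReal.ofReal ((R - power fun x : {x // P x} => f x) ^ j))⁻¹ =
      ∫⁻ f : V → ℂ, G (MeasurableEquiv.piEquivPiSubtypeProd (fun _ : V => ℂ) P f) := by
    rw [← lintegral_indicator hms]
    refine lintegral_congr fun f => ?_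
    have e := power_split P f
    simp only [Set.indicator, Set.mem_ofPred_eq, G, e]
    rfl
  rw [h1, hmp.lintegral_comp_emb (MeasurableEquiv.measurableEmbedding _)]
  refine (lintegral_prod_le _).trans ?_
  have h2 : ∀ g : {x // P x} → ℂ, ∫⁻ h, G (g, h) ≤
      {g : {x // P x} → ℂ | power g ≤ R}.indicator
        (fun _ => ENNReal.ofReal (Real.pi ^ j / j.factorial)) g := by
    intro g
    by_cases hg : power g ≤ R
    · have e : (fun h => G (g, h)) = {h : {x // ¬P x} → ℂ | power h ≤ R - power g}.indicator
          (fun _ => (ENNReal.ofReal ((R - power g) ^ j))⁻¹) := by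
        funext h
        simp only [G, Set.indicator, Set.mem_ofPred_eq]
        congr 1
        rw [eq_iff_iff]
        constructor <;> intro <;> linarith
      rw [e, lintegral_indicator (measurableSet_le measurable_power measurable_const),
        setLIntegral_const, volume_power_le _ (sub_nonneg.2 hg),
        Set.indicator_of_mem (by exact hg)]
      have e3 : ballVolume j (R - power g) = (R - power g) ^ j * (Real.pi ^ j / j.factorial) := by
        unfold ballVolume; rw [mul_pow]; ring
      rw [e3, ENNReal.ofReal_mul (pow_nonneg (sub_nonneg.2 hg) _), ← mul_assoc]
      exact mul_le_of_le_one_left' (ENNReal.inv_mul_le_one _)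
    · have e : (fun h => G (g, h)) = fun _ => 0 := by
        funext h
        simp only [G]
        rw [Set.indicator_of_notMem]
        have := power_nonneg h
        simp only [Set.mem_ofPred_eq]
        linarith
      rw [e]
      simp
  refine (lintegral_mono h2).trans ?_
  rw [lintegral_indicator (measurableSet_le measurable_power measurable_const),
    setLIntegral_const, volume_power_le _ hR, mul_comm,
    ← ENNReal.ofReal_mul (ballVolume_nonneg _ hR)]

theorem volume_condensed (x₀ : V) {r R : ℝ} (hr : 1 ≤ r) (hR : 0 ≤ R) :
    volume {f : V → ℂ | (r - 1 < ‖f x₀‖ ^ 2 ∧ ‖f x₀‖ ^ 2 ≤ r) ∧ power f ≤ ‖f x₀‖ ^ 2 + R} =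
      ENNReal.ofReal (Real.pi * ballVolume (Fintype.card V - 1) R) := by
  classical
  obtain ⟨P, hP⟩ : ∃ P : V → Prop, ∀ x, P x ↔ x = x₀ := ⟨_, fun _ => Iff.rfl⟩
  have hmp := volume_preserving_piEquivPiSubtypeProd (fun _ : V => ℂ) P
  have hp1 : ∀ g : {x // P x} → ℂ, power g = ‖g ⟨x₀, (hP x₀).2 rfl⟩‖ ^ 2 := by
    intro g
    unfold power
    refine Fintype.sum_eq_single _ fun x hx => absurd (Subtype.ext ((hP x).1 x.2)) hx
  let S₁ : Set ({x // P x} → ℂ) := {g | power g ≤ r} \ {g | power g ≤ r - 1}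
  let S₂ : Set ({x // ¬P x} → ℂ) := {g | power g ≤ R}
  have hS : {f : V → ℂ | (r - 1 < ‖f x₀‖ ^ 2 ∧ ‖f x₀‖ ^ 2 ≤ r) ∧ power f ≤ ‖f x₀‖ ^ 2 + R} =
      (MeasurableEquiv.piEquivPiSubtypeProd (fun _ : V => ℂ) P) ⁻¹' S₁ ×ˢ S₂ := by
    ext f
    have e := power_split P f
    rw [hp1] at e
    have e1 : f ∈ (MeasurableEquiv.piEquivPiSubtypeProd (fun _ : V => ℂ) P) ⁻¹'
        S₁ ×ˢ S₂ ↔ ((power (fun x : {x // P x} => f x) ≤ r ∧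
          ¬power (fun x : {x // P x} => f x) ≤ r - 1) ∧
          power (fun x : {x // ¬P x} => f x) ≤ R) := Iff.rfl
    rw [e1, hp1, Set.mem_ofPred_eq, e, not_le]
    simp only [add_le_add_iff_left]
    tauto
  have hm1 : MeasurableSet S₁ := (measurableSet_le measurable_power measurable_const).diff
    (measurableSet_le measurable_power measurable_const)
  have hm2 : MeasurableSet S₂ := measurableSet_le measurable_power measurable_const
  rw [hS, hmp.measure_preimage (hm1.prod hm2).nullMeasurableSet, Measure.volume_eq_prod,
    Measure.prod_prod]
  have hc : Fintype.card {x // P x} = 1 :=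
    Fintype.card_eq_one_iff.2 ⟨⟨x₀, (hP x₀).2 rfl⟩, fun x => Subtype.ext ((hP x).1 x.2)⟩
  have hv2 : volume S₂ = ENNReal.ofReal (ballVolume (Fintype.card V - 1) R) := by
    have h := volume_power_le {x // ¬P x} hR
    rw [Fintype.card_subtype_compl, hc] at h
    exact h
  have hv1 : volume S₁ = ENNReal.ofReal Real.pi := by
    have ha := volume_power_le {x // P x} (show 0 ≤ r by linarith)
    have hb := volume_power_le {x // P x} (show 0 ≤ r - 1 by linarith)
    have hsub : {g : {x // P x} → ℂ | power g ≤ r - 1} ⊆ {g | power g ≤ r} :=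
      fun g hg => le_trans (show power g ≤ r - 1 from hg) (by linarith)
    rw [measure_sdiff hsub
      (measurableSet_le measurable_power measurable_const).nullMeasurableSet
      (by rw [hb]; exact ENNReal.ofReal_ne_top), ha, hb, hc,
      ← ENNReal.ofReal_sub _ (ballVolume_nonneg 1 (by linarith))]
    congr 1
    simp [ballVolume]
    ring
  rw [hv1, hv2, ← ENNReal.ofReal_mul Real.pi_pos.le]

end Volume

/-! ### Big sites -/

section BigSites

variable {V : Type*} [Fintype V]

/-- The sites with `|f_x|² > √n`. The threshold is so high that there are `O (√n)` such sites, and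
so low that the other sites add only `O (√n)` to `∑ |f_x|⁴ / n`. -/
noncomputable def bigSites (f : V → ℂ) : Finset V :=
  {x | √(Fintype.card V : ℝ) < ‖f x‖ ^ 2}

/-- The sum of `|f_x|²` over the big sites. -/
noncomputable def bigMass (f : V → ℂ) : ℝ := ∑ x ∈ bigSites f, ‖f x‖ ^ 2

/-- The sum of `|f_x|⁴` over the big sites. -/
noncomputable def bigQuartic (f : V → ℂ) : ℝ := ∑ x ∈ bigSites f, ‖f x‖ ^ 4

/-- The sum of `|f_x|⁴` over all sites. -/
noncomputable def quartic (f : V → ℂ) : ℝ := ∑ x, ‖f x‖ ^ 4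

theorem mem_bigSites {f : V → ℂ} {x : V} :
    x ∈ bigSites f ↔ √(Fintype.card V : ℝ) < ‖f x‖ ^ 2 := by
  simp [bigSites]

theorem bigMass_nonneg (f : V → ℂ) : 0 ≤ bigMass f := Finset.sum_nonneg fun _ _ => by positivity

theorem bigMass_le_power (f : V → ℂ) : bigMass f ≤ power f :=
  Finset.sum_le_univ_sum_of_nonneg fun _ => by positivity

theorem bigQuartic_le_quartic (f : V → ℂ) : bigQuartic f ≤ quartic f :=
  Finset.sum_le_univ_sum_of_nonneg fun _ => by positivity

theorem bigQuartic_le (f : V → ℂ) : bigQuartic f ≤ bigMass f ^ 2 := by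
  have h : bigQuartic f = ∑ x ∈ bigSites f, (‖f x‖ ^ 2) ^ 2 :=
    Finset.sum_congr rfl fun _ _ => by ring
  rw [h]
  rw [pow_two, bigMass, Finset.sum_mul]
  refine Finset.sum_le_sum fun x hx => ?_
  rw [pow_two]
  exact mul_le_mul_of_nonneg_left
    (Finset.single_le_sum (f := fun x => ‖f x‖ ^ 2) (fun _ _ => by positivity) hx) (by positivity)

theorem quartic_le (f : V → ℂ) :
    quartic f ≤ bigQuartic f + √(Fintype.card V : ℝ) * power f := by
  classical
  unfold quartic bigQuartic power
  rw [Finset.mul_sum, ← Finset.sum_add_sum_compl (bigSites f)]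
  refine add_le_add le_rfl ?_
  calc ∑ x ∈ (bigSites f)ᶜ, ‖f x‖ ^ 4
      ≤ ∑ x ∈ (bigSites f)ᶜ, √(Fintype.card V : ℝ) * ‖f x‖ ^ 2 := by
        refine Finset.sum_le_sum fun x hx => ?_
        rw [Finset.mem_compl, mem_bigSites, not_lt] at hx
        have : ‖f x‖ ^ 4 = ‖f x‖ ^ 2 * ‖f x‖ ^ 2 := by ring
        rw [this]
        gcongr
    _ ≤ _ := Finset.sum_le_univ_sum_of_nonneg fun _ => by positivity

theorem card_bigSites_mul_le (f : V → ℂ) :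
    ((bigSites f).card : ℝ) * √(Fintype.card V : ℝ) ≤ power f := by
  refine le_trans ?_ (bigMass_le_power f)
  rw [← nsmul_eq_mul]
  exact Finset.card_nsmul_le_sum _ _ _ fun x hx => (mem_bigSites.1 hx).le

theorem card_bigSites_le [Nonempty V] {B : ℝ} {f : V → ℂ}
    (hf : power f ≤ B * (Fintype.card V : ℝ)) :
    ((bigSites f).card : ℝ) ≤ B * √(Fintype.card V : ℝ) := by
  have hn : (0 : ℝ) < Fintype.card V := by exact_mod_cast Fintype.card_pos
  have hs := Real.sqrt_pos.2 hn
  refine le_of_mul_le_mul_right ((card_bigSites_mul_le f).trans (hf.trans_eq ?_)) hs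
  rw [mul_assoc, Real.mul_self_sqrt hn.le]

theorem quartic_le_of_bigMass_le {B t : ℝ} {f : V → ℂ}
    (hf : power f ≤ B * Fintype.card V) (hm : bigMass f ≤ t / 2)
    (ht : B * (Fintype.card V : ℝ) * √(Fintype.card V : ℝ) ≤ t ^ 2 / 2) : quartic f ≤ t ^ 2 := by
  have h1 := quartic_le f
  have h2 := bigQuartic_le f
  have h3 : bigMass f ^ 2 ≤ (t / 2) ^ 2 := pow_le_pow_left₀ (bigMass_nonneg f) hm 2
  have h4 : √(Fintype.card V : ℝ) * power f ≤ √(Fintype.card V : ℝ) * (B * Fintype.card V) := by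
    gcongr
  nlinarith [sq_nonneg t]

end BigSites

/-! ### The upper bound for the exponential integral of the quartic term -/

section UpperBound

variable {V : Type*} [Fintype V]

theorem measurable_quartic : Measurable (quartic : (V → ℂ) → ℝ) := by
  unfold quartic
  fun_prop

theorem power_subtype {A : Finset V} {P : V → Prop} [DecidablePred P] (hP : ∀ x, x ∈ A ↔ P x)
    (f : V → ℂ) : (power fun x : {x // P x} => f x) = ∑ x ∈ A, ‖f x‖ ^ 2 :=
  (Finset.sum_subtype A hP (fun x => ‖f x‖ ^ 2)).symm

/-- The error in the exponent of the upper bound: `2 B √n log n` for the choice of the big sites,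
`b B √n` for the quartic term of the other sites, and `b B³ √n` because the ball of the other sites
has dimension `n - k` instead of `n`. -/
noncomputable def entropyErr (b B n : ℝ) : ℝ :=
  1 + 2 * (B * √n) * Real.log n + (b * B + b * B ^ 3) * √n

theorem ballVolume_mul_ballVolume {n k j : ℕ} (h : k + j = n) (R : ℝ) :
    ballVolume k R * ballVolume j R = ballVolume n R * n.choose k := by
  have hf := Nat.choose_mul_factorial_mul_factorial (Nat.le_of_add_right_le h.le)
  rw [show n - k = j by omega] at hf
  have hf' : ((n.choose k : ℝ) * k.factorial * j.factorial) = n.factorial := by exact_mod_cast hf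
  have h1 : (k.factorial : ℝ) ≠ 0 := by positivity
  have h2 : (j.factorial : ℝ) ≠ 0 := by positivity
  have h3 : (n.factorial : ℝ) ≠ 0 := by positivity
  unfold ballVolume
  rw [← h, pow_add]
  rw [← h] at h3 hf'
  field_simp
  linear_combination -((Real.pi * R) ^ k * (Real.pi * R) ^ j) * hf'

/-- The pointwise bound behind the upper bound: the exponential weight times the volume (up to a
constant) of the slice along the coordinates of the other `j` sites. -/
theorem exp_quartic_mul_pow_le [Nonempty V] {b B R g d : ℝ} (hb : 0 ≤ b)
    (hR : R ≤ B * Fintype.card V) {f : V → ℂ} (hf : power f ≤ R)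
    (hfE : (R - bigMass f) * Real.exp (b * bigQuartic f / (Fintype.card V : ℝ) ^ 2) ≤
      B * Fintype.card V * Real.exp (g - d)) {j : ℕ}
    (hj : (bigSites f).card + j = Fintype.card V) :
    Real.exp (b * quartic f / Fintype.card V) * (R - bigMass f) ^ j ≤
      Real.exp (b * B * √(Fintype.card V : ℝ) + b * B ^ 2 * (bigSites f).card) *
        (B * Fintype.card V * Real.exp (g - d)) ^ j := by
  set n : ℝ := (Fintype.card V : ℝ) with hn
  have hn0 : 0 < n := by rw [hn]; exact_mod_cast Fintype.card_pos
  have hm : bigMass f ≤ B * n := (bigMass_le_power f).trans (hf.trans hR)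
  have hj' : ((bigSites f).card : ℝ) + j = n := by rw [hn, ← hj]; push_cast; ring
  have h1 : b * quartic f / n ≤ b * B * √n + b * bigQuartic f / n := by
    rw [div_le_iff₀ hn0, add_mul, div_mul_cancel₀ _ hn0.ne']
    have h2 : √n * power f ≤ √n * (B * n) := by gcongr; exact hf.trans hR
    have h3 := mul_le_mul_of_nonneg_left ((quartic_le f).trans (add_le_add_right h2 _)) hb
    linarith
  have h2 : bigQuartic f ≤ (B * n) ^ 2 :=
    (bigQuartic_le f).trans (pow_le_pow_left₀ (bigMass_nonneg f) hm 2)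
  have h3 : b * bigQuartic f / n ≤
      j * (b * bigQuartic f / n ^ 2) + b * B ^ 2 * (bigSites f).card := by
    have e : b * bigQuartic f / n =
        j * (b * bigQuartic f / n ^ 2) + (bigSites f).card * (b * bigQuartic f / n ^ 2) := by
      rw [← add_mul, add_comm (j : ℝ), hj']
      field_simp
    rw [e]
    have : b * bigQuartic f / n ^ 2 ≤ b * B ^ 2 := by
      rw [div_le_iff₀ (by positivity)]
      nlinarith
    have := mul_le_mul_of_nonneg_left this (Nat.cast_nonneg (α := ℝ) (bigSites f).card)
    linarith
  have h4 : 0 ≤ R - bigMass f := sub_nonneg.2 ((bigMass_le_power f).trans hf)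
  calc Real.exp (b * quartic f / n) * (R - bigMass f) ^ j
      ≤ Real.exp (b * B * √n + b * B ^ 2 * (bigSites f).card +
          j * (b * bigQuartic f / n ^ 2)) * (R - bigMass f) ^ j := by
        gcongr
        linarith
    _ = Real.exp (b * B * √n + b * B ^ 2 * (bigSites f).card) *
          ((R - bigMass f) * Real.exp (b * bigQuartic f / n ^ 2)) ^ j := by
        rw [Real.exp_add, mul_pow, ← Real.exp_nat_mul]
        ring
    _ ≤ _ := by gcongr

/-- The contribution of the configurations with a given set `A` of big sites. The factor
`(1 / n) ^ #A` makes the bounds summable over `A`. -/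
theorem lintegral_exp_quartic_fiber_le [Nonempty V] {b B R g d : ℝ} (hb : 0 ≤ b) (hB : 0 < B)
    (hR0 : 0 ≤ R) (hR : R ≤ B * Fintype.card V) (hg : 0 ≤ g) (hd : 0 ≤ d)
    (hn : B * √(Fintype.card V : ℝ) ≤ (Fintype.card V : ℝ) / 2) {E : Set (V → ℂ)}
    (hE : ∀ f ∈ E, power f ≤ R ∧
      (R - bigMass f) * Real.exp (b * bigQuartic f / (Fintype.card V : ℝ) ^ 2) ≤
        B * Fintype.card V * Real.exp (g - d)) (A : Finset V) :
    ∫⁻ f in E ∩ {f | bigSites f = A}, ENNReal.ofReal (Real.exp (b * quartic f / Fintype.card V)) ≤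
      ENNReal.ofReal (ballVolume (Fintype.card V) (B * Fintype.card V) *
        Real.exp (Fintype.card V * g - Fintype.card V * d / 2 +
          (entropyErr b B (Fintype.card V) - 1)) * (1 / (Fintype.card V : ℝ)) ^ A.card) := by
  classical
  rcases Set.eq_empty_or_nonempty (E ∩ {f | bigSites f = A}) with h0 | ⟨f₀, hf₀, hA⟩
  · rw [h0]; simp
  set N := Fintype.card V with hN
  set k := A.card with hk
  have hN0 : 0 < N := Fintype.card_pos
  have hN0' : (0 : ℝ) < N := by exact_mod_cast hN0
  have hN1 : (1 : ℝ) ≤ N := by exact_mod_cast hN0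
  have hkB : (k : ℝ) ≤ B * √(N : ℝ) := by
    have := card_bigSites_le ((hE f₀ hf₀).1.trans hR)
    rwa [show bigSites f₀ = A from hA] at this
  have hkN : k ≤ N := Finset.card_le_univ A
  obtain ⟨j, hj⟩ : ∃ j, k + j = N := ⟨N - k, by omega⟩
  have hjr : (k : ℝ) + j = N := by exact_mod_cast hj
  have hj0 : j ≠ 0 := by
    rintro rfl
    simp only [Nat.cast_zero, add_zero] at hjr
    linarith
  obtain ⟨P, hP⟩ : ∃ P : V → Prop, ∀ x, x ∈ A ↔ P x := ⟨_, fun _ => Iff.rfl⟩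
  have hcA : Fintype.card {x // P x} = k := Fintype.card_of_subtype A hP
  have hcA' : Fintype.card {x // ¬P x} = j := by
    rw [Fintype.card_subtype_compl, hcA]; omega
  set c : ℝ := Real.exp (b * B * √(N : ℝ) + b * B ^ 2 * k) * (B * N * Real.exp (g - d)) ^ j with hc
  have hc0 : 0 < c := by positivity
  have hslice := lintegral_inv_slice_le P hR0
  rw [hcA, hcA'] at hslice
  have hmeas : Measurable fun f : V → ℂ =>
      (ENNReal.ofReal ((R - power fun x : {x // P x} => f x) ^ j))⁻¹ := by
    unfold power
    fun_prop
  have hpt : ∀ f ∈ E ∩ {f | bigSites f = A}, ENNReal.ofReal (Real.exp (b * quartic f / N)) ≤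
      ENNReal.ofReal c * (ENNReal.ofReal ((R - power fun x : {x // P x} => f x) ^ j))⁻¹ := by
    rintro f ⟨hf, rfl⟩
    obtain ⟨hf1, hf2⟩ := hE f hf
    rw [power_subtype hP]
    change _ ≤ ENNReal.ofReal c * (ENNReal.ofReal ((R - bigMass f) ^ j))⁻¹
    have hle := exp_quartic_mul_pow_le hb hR hf1 hf2 hj
    have hnn : 0 ≤ R - bigMass f := sub_nonneg.2 ((bigMass_le_power f).trans hf1)
    -- on the null set `bigMass f = R` the right-hand side is infinite
    rcases hnn.eq_or_lt with h | h
    · rw [← h, zero_pow hj0, ENNReal.ofReal_zero, ENNReal.inv_zero,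
        ENNReal.mul_top (by simpa using hc0)]
      exact le_top
    · have hp : 0 < (R - bigMass f) ^ j := pow_pos h j
      rw [← ENNReal.ofReal_inv_of_pos hp, ← ENNReal.ofReal_mul hc0.le]
      apply ENNReal.ofReal_le_ofReal
      rw [← div_eq_mul_inv, le_div_iff₀ hp]
      exact hle
  refine (setLIntegral_mono (hmeas.const_mul _) hpt).trans ?_
  rw [lintegral_const_mul _ hmeas]
  have hsub : E ∩ {f | bigSites f = A} ⊆ {f : V → ℂ | power f ≤ R} := fun f hf => (hE f hf.1).1
  refine (mul_le_mul_right ((lintegral_mono_set hsub).trans hslice) _).trans ?_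
  rw [← ENNReal.ofReal_mul hc0.le]
  apply ENNReal.ofReal_le_ofReal
  have hpi := Real.pi_pos
  have h1 : ballVolume k R ≤ ballVolume k (B * N) := by
    unfold ballVolume
    gcongr
  have h2 : (Nat.choose N k : ℝ) ≤ (N : ℝ) ^ k := by exact_mod_cast Nat.choose_le_pow N k
  have h3 : (N : ℝ) ^ k ≤ Real.exp (2 * (B * √(N : ℝ)) * Real.log N) * (1 / (N : ℝ)) ^ k := by
    have e : (N : ℝ) ^ k = Real.exp (2 * k * Real.log N) * (1 / (N : ℝ)) ^ k := by
      rw [mul_comm (2 : ℝ), mul_assoc, Real.exp_nat_mul, mul_comm (2 : ℝ), Real.exp_mul,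
        Real.exp_log hN0', ← mul_pow, Real.rpow_two]
      congr 1
      field_simp
    rw [e]
    gcongr
  -- `j ≤ N` for the term `g`, and `N / 2 ≤ j` for the term `d`
  have h4 : (j : ℝ) * (g - d) ≤ N * g - N * d / 2 := by
    have h5 : (k : ℝ) ≤ N / 2 := hkB.trans hn
    have h6 : (j : ℝ) = N - k := by linarith
    rw [h6]
    nlinarith [mul_nonneg (Nat.cast_nonneg (α := ℝ) k) hg]
  have h7 : Real.exp (b * B * √(N : ℝ) + b * B ^ 2 * k) ≤
      Real.exp ((b * B + b * B ^ 3) * √(N : ℝ)) := by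
    apply Real.exp_le_exp.2
    have := mul_le_mul_of_nonneg_left hkB (by positivity : 0 ≤ b * B ^ 2)
    nlinarith
  have hbn : 0 ≤ ballVolume N (B * N) := ballVolume_nonneg _ (by positivity)
  calc c * (ballVolume k R * (Real.pi ^ j / j.factorial))
      ≤ c * (ballVolume k (B * N) * (Real.pi ^ j / j.factorial)) := by gcongr
    _ = Real.exp (b * B * √(N : ℝ) + b * B ^ 2 * k) * Real.exp (j * (g - d)) *
          (ballVolume k (B * N) * ballVolume j (B * N)) := by
        rw [hc, mul_pow _ (Real.exp (g - d)), ← Real.exp_nat_mul]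
        unfold ballVolume
        rw [mul_pow Real.pi (B * N) j]
        ring
    _ = Real.exp (b * B * √(N : ℝ) + b * B ^ 2 * k) * Real.exp (j * (g - d)) *
          (ballVolume N (B * N) * N.choose k) := by rw [ballVolume_mul_ballVolume hj]
    _ ≤ Real.exp ((b * B + b * B ^ 3) * √(N : ℝ)) * Real.exp (N * g - N * d / 2) *
          (ballVolume N (B * N) *
            (Real.exp (2 * (B * √(N : ℝ)) * Real.log N) * (1 / (N : ℝ)) ^ k)) := by
        have := h2.trans h3
        gcongr
    _ = _ := by
        have e : (N : ℝ) * g - N * d / 2 + (entropyErr b B N - 1) =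
            (b * B + b * B ^ 3) * √(N : ℝ) + (N * g - N * d / 2) +
              2 * (B * √(N : ℝ)) * Real.log N := by unfold entropyErr; ring
        rw [e, Real.exp_add, Real.exp_add]
        ring

/-- The upper bound. If on `E`, inside the ball `power f ≤ R`, the weight per dimension is at most
`exp (g - d)` times that of the whole ball, then the integral over `E` gains at least half of the
deficit `n d`, up to `entropyErr`. -/
theorem lintegral_exp_quartic_le [Nonempty V] {b B R g d : ℝ} (hb : 0 ≤ b) (hB : 0 < B)
    (hR : R ≤ B * Fintype.card V) (hg : 0 ≤ g) (hd : 0 ≤ d)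
    (hn : B * √(Fintype.card V : ℝ) ≤ (Fintype.card V : ℝ) / 2) {E : Set (V → ℂ)}
    (hE : ∀ f ∈ E, power f ≤ R ∧
      (R - bigMass f) * Real.exp (b * bigQuartic f / (Fintype.card V : ℝ) ^ 2) ≤
        B * Fintype.card V * Real.exp (g - d)) :
    ∫⁻ f in E, ENNReal.ofReal (Real.exp (b * quartic f / Fintype.card V)) ≤
      ENNReal.ofReal (ballVolume (Fintype.card V) (B * Fintype.card V) *
        Real.exp (Fintype.card V * g - Fintype.card V * d / 2 +
          entropyErr b B (Fintype.card V))) := by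
  rcases lt_or_ge R 0 with hR0 | hR0
  · have : E = ∅ := Set.eq_empty_of_forall_notMem fun f hf => by
      have h1 := (hE f hf).1
      have h2 := power_nonneg f
      linarith
    rw [this]; simp
  have hN0 : (0 : ℝ) < Fintype.card V := by exact_mod_cast Fintype.card_pos
  have hcov : E = ⋃ A : Finset V, E ∩ {f | bigSites f = A} := by
    ext f; simp
  have hbn : 0 ≤ ballVolume (Fintype.card V) (B * Fintype.card V) :=
    ballVolume_nonneg _ (by positivity)
  rw [hcov]
  refine (lintegral_iUnion_le _ _).trans ?_
  rw [tsum_fintype]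
  refine (Finset.sum_le_sum fun A _ =>
    lintegral_exp_quartic_fiber_le hb hB hR0 hR hg hd hn hE A).trans ?_
  rw [← ENNReal.ofReal_sum_of_nonneg fun _ _ => by positivity]
  apply ENNReal.ofReal_le_ofReal
  rw [← Finset.mul_sum]
  have h1 := Fintype.sum_pow_mul_eq_add_pow V (1 / (Fintype.card V : ℝ)) 1
  simp only [one_pow, mul_one] at h1
  rw [h1]
  have h2 : (1 / (Fintype.card V : ℝ) + 1) ^ Fintype.card V ≤ Real.exp 1 := by
    calc (1 / (Fintype.card V : ℝ) + 1) ^ Fintype.card V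
        ≤ Real.exp (1 / (Fintype.card V : ℝ)) ^ Fintype.card V := by
          gcongr
          exact Real.add_one_le_exp _
      _ = Real.exp 1 := by
          rw [← Real.exp_nat_mul]
          congr 1
          field_simp
  refine (mul_le_mul_of_nonneg_left h2 (by positivity)).trans_eq ?_
  rw [mul_assoc, ← Real.exp_add]
  congr 2
  ring

end UpperBound

/-! ### The gradient term and lower bounds for the partition function -/

section Gibbs

variable {V : Type*} [Fintype V] [DecidableEq V] (G : SimpleGraph V) [DecidableRel G.Adj]

theorem gradSq_nonneg {α : Type*} (h : ℝ) (f : α → ℂ) (e : Sym2 α) : 0 ≤ gradSq h f e := by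
  induction e with
  | _ x y => simp only [gradSq, Sym2.lift_mk]; positivity

theorem gradSq_le (h : ℝ) (f : V → ℂ) {e : Sym2 V} (he : e ∈ G.edgeFinset) :
    gradSq h f e ≤ 2 / h ^ 2 * ∑ x, if x ∈ e then ‖f x‖ ^ 2 else 0 := by
  induction e with
  | _ x y =>
    have hxy : x ≠ y := by
      rw [SimpleGraph.mem_edgeFinset, SimpleGraph.mem_edgeSet] at he
      exact he.ne
    have e1 : (∑ z, if z ∈ s(x, y) then ‖f z‖ ^ 2 else 0) = ‖f x‖ ^ 2 + ‖f y‖ ^ 2 := by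
      rw [← Finset.sum_filter]
      have : (Finset.univ.filter fun z => z ∈ s(x, y)) = {x, y} := by ext z; simp
      rw [this, Finset.sum_pair hxy]
    rw [e1]
    simp only [gradSq, Sym2.lift_mk]
    rw [norm_div, div_pow, Complex.norm_real, Real.norm_eq_abs, sq_abs, div_mul_eq_mul_div]
    gcongr
    have h1 : ‖f x - f y‖ ≤ ‖f x‖ + ‖f y‖ := norm_sub_le _ _
    nlinarith [norm_nonneg (f x - f y), sq_nonneg (‖f x‖ - ‖f y‖), norm_nonneg (f x),
      norm_nonneg (f y)]

theorem sum_gradSq_le (h : ℝ) (f : V → ℂ) :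
    ∑ e ∈ G.edgeFinset, gradSq h f e ≤ 2 / h ^ 2 * (G.maxDegree * power f) := by
  refine (Finset.sum_le_sum fun e he => gradSq_le G h f he).trans ?_
  rw [← Finset.mul_sum, Finset.sum_comm]
  gcongr
  rw [power, Finset.mul_sum]
  refine Finset.sum_le_sum fun x _ => ?_
  rw [← Finset.sum_filter, Finset.sum_const, nsmul_eq_mul, ← G.incidenceFinset_eq_filter,
    G.card_incidenceFinset_eq_degree]
  gcongr
  exact G.degree_le_maxDegree x

/-- An upper bound for the gradient part of the Hamiltonian on the ball `power f ≤ B n`, for a graph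
of maximum degree `D`. -/
noncomputable def gradBound (D : ℕ) (B p n : ℝ) : ℝ := 4 * D * B * n ^ (2 * p)

variable {G}

theorem hamiltonian_add_nonneg (h : ℝ) (f : V → ℂ) :
    0 ≤ hamiltonian G h f + quartic f / Fintype.card V := by
  have : 0 ≤ ∑ e ∈ G.edgeFinset, gradSq h f e := Finset.sum_nonneg fun _ _ => gradSq_nonneg _ _ _
  have e : hamiltonian G h f + quartic f / Fintype.card V =
      2 / (Fintype.card V : ℝ) * ∑ e ∈ G.edgeFinset, gradSq h f e := by
    unfold hamiltonian quartic; ring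
  rw [e]
  positivity

theorem hamiltonian_add_le [Nonempty V] {p B : ℝ} {f : V → ℂ}
    (hf : power f ≤ B * Fintype.card V) :
    hamiltonian G (spacing V p) f + quartic f / Fintype.card V ≤
      gradBound G.maxDegree B p (Fintype.card V) := by
  have hn0 : (0 : ℝ) < Fintype.card V := by exact_mod_cast Fintype.card_pos
  have e : hamiltonian G (spacing V p) f + quartic f / Fintype.card V =
      2 / (Fintype.card V : ℝ) * ∑ e ∈ G.edgeFinset, gradSq (spacing V p) f e := by
    unfold hamiltonian quartic; ring
  have hs : 2 / spacing V p ^ 2 = 2 * (Fintype.card V : ℝ) ^ (2 * p) := by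
    unfold spacing
    rw [← Real.rpow_natCast, ← Real.rpow_mul hn0.le, div_eq_mul_inv, ← Real.rpow_neg hn0.le]
    congr 2
    push_cast
    ring
  rw [e]
  calc 2 / (Fintype.card V : ℝ) * ∑ e ∈ G.edgeFinset, gradSq (spacing V p) f e
      ≤ 2 / (Fintype.card V : ℝ) * (2 / spacing V p ^ 2 *
          (G.maxDegree * (B * Fintype.card V))) := by
        gcongr
        refine (sum_gradSq_le G _ f).trans ?_
        gcongr
    _ = _ := by
        rw [hs, gradBound]
        field_simp
        ring

theorem gibbsWeight_apply (h β B : ℝ) (E : Set (V → ℂ)) :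
    gibbsWeight G h β B E = ∫⁻ f in E ∩ {f | power f ≤ B * Fintype.card V},
      ENNReal.ofReal (Real.exp (-β * hamiltonian G h f)) := by
  rw [gibbsWeight, withDensity_apply', Measure.restrict_restrict'
    (measurableSet_le measurable_power measurable_const)]

theorem gibbsWeight_le [Nonempty V] (p β B : ℝ) {E : Set (V → ℂ)}
    (hE : ∀ f ∈ E, power f ≤ B * Fintype.card V) :
    gibbsWeight G (spacing V p) β B E ≤
      ENNReal.ofReal (Real.exp (|β| * gradBound G.maxDegree B p (Fintype.card V))) *
        ∫⁻ f in E, ENNReal.ofReal (Real.exp (max β 0 * quartic f / Fintype.card V)) := by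
  have hn0 : (0 : ℝ) < Fintype.card V := by exact_mod_cast Fintype.card_pos
  have hm : Measurable fun f : V → ℂ =>
      ENNReal.ofReal (Real.exp (max β 0 * quartic f / Fintype.card V)) := by
    have := measurable_quartic (V := V)
    fun_prop
  rw [gibbsWeight_apply, Set.inter_eq_left.2 (show E ⊆ {f | power f ≤ B * Fintype.card V} from hE),
    ← lintegral_const_mul _ hm]
  refine setLIntegral_mono (hm.const_mul _) fun f hf => ?_
  rw [← ENNReal.ofReal_mul (Real.exp_pos _).le, ← Real.exp_add]
  apply ENNReal.ofReal_le_ofReal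
  apply Real.exp_le_exp.2
  have h0 := hamiltonian_add_nonneg (G := G) (spacing V p) f
  have h1 := hamiltonian_add_le (G := G) (p := p) (hE f hf)
  have h2 : 0 ≤ quartic f / Fintype.card V :=
    div_nonneg (Finset.sum_nonneg fun _ _ => by positivity) hn0.le
  have h3 : -β * (hamiltonian G (spacing V p) f + quartic f / Fintype.card V) ≤
      |β| * gradBound G.maxDegree B p (Fintype.card V) := by
    refine (mul_le_mul_of_nonneg_right (neg_le_abs β) h0).trans ?_
    exact mul_le_mul_of_nonneg_left h1 (abs_nonneg β)
  have h4 : β * (quartic f / Fintype.card V) ≤ max β 0 * (quartic f / Fintype.card V) :=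
    mul_le_mul_of_nonneg_right (le_max_left _ _) h2
  rw [mul_div_assoc]
  linarith

theorem mul_volume_le_partitionFn [Nonempty V] (p β B t : ℝ) {F : Set (V → ℂ)}
    (hF : MeasurableSet F) (hFB : ∀ f ∈ F, power f ≤ B * Fintype.card V)
    (ht : ∀ f ∈ F, t ≤ β * (quartic f / Fintype.card V)) :
    ENNReal.ofReal (Real.exp (t - |β| * gradBound G.maxDegree B p (Fintype.card V))) * volume F ≤
      partitionFn G (spacing V p) β B := by
  rw [partitionFn]
  refine le_trans ?_ (measure_mono (Set.subset_univ F))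
  rw [gibbsWeight_apply, Set.inter_eq_left.2 (show F ⊆ {f | power f ≤ B * Fintype.card V} from hFB),
    ← setLIntegral_const]
  refine setLIntegral_mono' hF fun f hf => ?_
  apply ENNReal.ofReal_le_ofReal
  apply Real.exp_le_exp.2
  have h0 := hamiltonian_add_nonneg (G := G) (spacing V p) f
  have h1 := hamiltonian_add_le (G := G) (p := p) (hFB f hf)
  have h3 : β * (hamiltonian G (spacing V p) f + quartic f / Fintype.card V) ≤
      |β| * gradBound G.maxDegree B p (Fintype.card V) := by
    refine (mul_le_mul_of_nonneg_right (le_abs_self β) h0).trans ?_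
    exact mul_le_mul_of_nonneg_left h1 (abs_nonneg β)
  have := ht f hf
  linarith

/-- Half of the ball consists of configurations without a large component: those with mass
at least `t / 2` on big sites are rare by the upper bound with `b = 0`. On the rest
`quartic f ≤ t²`, so the weight is not small there, whatever the sign of `β`. -/
theorem partitionFn_ge_spread [Nonempty V] (p β : ℝ) {B t : ℝ} (hB : 0 < B) (ht0 : 0 ≤ t)
    (hn : B * √(Fintype.card V : ℝ) ≤ (Fintype.card V : ℝ) / 2)
    (ht : B * (Fintype.card V : ℝ) * √(Fintype.card V : ℝ) ≤ t ^ 2 / 2)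
    (he : entropyErr 0 B (Fintype.card V) - t / (4 * B) ≤ -Real.log 2) :
    ENNReal.ofReal (ballVolume (Fintype.card V) (B * Fintype.card V) *
      Real.exp (-(|β| * (t ^ 2 / Fintype.card V) +
        |β| * gradBound G.maxDegree B p (Fintype.card V) + Real.log 2))) ≤
      partitionFn G (spacing V p) β B := by
  have hn0 : (0 : ℝ) < Fintype.card V := by exact_mod_cast Fintype.card_pos
  set n : ℝ := (Fintype.card V : ℝ) with hnn
  set W := ballVolume (Fintype.card V) (B * n) with hW
  have hW0 : 0 ≤ W := ballVolume_nonneg _ (by positivity)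
  let S : Set (V → ℂ) := {f | power f ≤ B * n}
  let F : Set (V → ℂ) := {f | power f ≤ B * n ∧ quartic f ≤ t ^ 2}
  let E : Set (V → ℂ) := {f | power f ≤ B * n ∧ t / 2 < bigMass f}
  have hFm : MeasurableSet F := (measurableSet_le measurable_power measurable_const).inter
    (measurableSet_le measurable_quartic measurable_const)
  have hSEF : S ⊆ E ∪ F := by
    intro f hf
    by_cases h : t / 2 < bigMass f
    · exact Or.inl ⟨hf, h⟩
    · exact Or.inr ⟨hf, quartic_le_of_bigMass_le hf (not_lt.1 h) ht⟩
  have hvE : volume E ≤ ENNReal.ofReal (W / 2) := by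
    have h := lintegral_exp_quartic_le (V := V) (b := 0) (B := B) (R := B * n) (g := 0)
      (d := t / (2 * B * n)) le_rfl hB le_rfl le_rfl (by positivity) hn (E := E) (by
        rintro f ⟨hf, hm⟩
        refine ⟨hf, ?_⟩
        simp only [zero_mul, zero_div, Real.exp_zero, mul_one, zero_sub]
        have h1 := Real.add_one_le_exp (-(t / (2 * B * n)))
        have h2 := mul_le_mul_of_nonneg_left h1 (by positivity : 0 ≤ B * n)
        have h3 : B * n * (-(t / (2 * B * n)) + 1) = B * n - t / 2 := by
          field_simp
          ring
        rw [← hnn]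
        linarith)
    simp only [zero_mul, zero_div, Real.exp_zero, ENNReal.ofReal_one, lintegral_const, one_mul,
      Measure.restrict_apply_univ, mul_zero, zero_sub] at h
    refine h.trans (ENNReal.ofReal_le_ofReal ?_)
    rw [div_eq_mul_inv W 2]
    refine mul_le_mul_of_nonneg_left ?_ hW0
    rw [← Real.exp_log (show (0 : ℝ) < 2⁻¹ by norm_num), Real.log_inv]
    apply Real.exp_le_exp.2
    have e : n * (t / (2 * B * n)) / 2 = t / (4 * B) := by
      field_simp
      ring
    rw [← hnn, e]
    linarith
  have hvF : ENNReal.ofReal (W / 2) ≤ volume F := by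
    have h1 : volume S = ENNReal.ofReal W := volume_power_le V (by positivity)
    have h2 : volume S ≤ volume E + volume F :=
      (measure_mono hSEF).trans (measure_union_le _ _)
    have h3 : ENNReal.ofReal (W / 2) + ENNReal.ofReal (W / 2) ≤
        ENNReal.ofReal (W / 2) + volume F := by
      rw [← ENNReal.ofReal_add (by positivity) (by positivity), add_halves, ← h1]
      exact h2.trans (by gcongr)
    exact (ENNReal.add_le_add_iff_left ENNReal.ofReal_ne_top).1 h3
  refine le_trans ?_ (mul_volume_le_partitionFn p β B (-(|β| * (t ^ 2 / n))) hFm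
    (fun f hf => hf.1) (fun f hf => ?_))
  · refine le_trans ?_ (mul_le_mul_right hvF _)
    rw [← ENNReal.ofReal_mul (Real.exp_pos _).le]
    apply ENNReal.ofReal_le_ofReal
    rw [neg_add, neg_add, ← sub_eq_add_neg, ← sub_eq_add_neg, Real.exp_sub _ (Real.log 2),
      Real.exp_log two_pos]
    apply le_of_eq
    ring
  · have h0 : 0 ≤ quartic f := Finset.sum_nonneg fun _ _ => by positivity
    have h1 : |β * (quartic f / n)| ≤ |β| * (t ^ 2 / n) := by
      rw [abs_mul, abs_of_nonneg (div_nonneg h0 hn0.le)]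
      gcongr
      exact hf.2
    exact neg_le_of_abs_le h1

/-- The contribution of the configurations with mass in `(a n - 1, a n]` at one site and mass at
most `(B - a) n` elsewhere. -/
theorem partitionFn_ge_condensed [Nonempty V] (p : ℝ) {β B a : ℝ} (hβ : 0 ≤ β) (ha : 0 < a)
    (haB : a < B) (hn : 1 ≤ a * Fintype.card V) :
    ENNReal.ofReal (ballVolume (Fintype.card V) (B * Fintype.card V) *
      Real.exp (Fintype.card V * (β * a ^ 2 + Real.log (1 - a / B)) -
        (2 * β * a + |β| * gradBound G.maxDegree B p (Fintype.card V) + Real.log B))) ≤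
      partitionFn G (spacing V p) β B := by
  obtain ⟨x₀⟩ := ‹Nonempty V›
  have : Nonempty V := ⟨x₀⟩
  have hN0 : 0 < Fintype.card V := Fintype.card_pos
  obtain ⟨M, hM⟩ : ∃ M, Fintype.card V = M + 1 := ⟨Fintype.card V - 1, by omega⟩
  set n : ℝ := (Fintype.card V : ℝ) with hnn
  have hn0 : 0 < n := by rw [hnn]; exact_mod_cast hN0
  have hB : 0 < B := ha.trans haB
  have hpi := Real.pi_pos
  have hv := volume_condensed x₀ (r := a * n) (R := (B - a) * n) hn
    (mul_nonneg (by linarith) hn0.le)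
  set F := {f : V → ℂ | (a * n - 1 < ‖f x₀‖ ^ 2 ∧ ‖f x₀‖ ^ 2 ≤ a * n) ∧
    power f ≤ ‖f x₀‖ ^ 2 + (B - a) * n} with hF
  have hFm : MeasurableSet F := by
    have h1 : Measurable fun f : V → ℂ => ‖f x₀‖ ^ 2 := by fun_prop
    exact ((measurableSet_lt measurable_const h1).inter
      (measurableSet_le h1 measurable_const)).inter
      (measurableSet_le measurable_power (h1.add_const _))
  refine le_trans ?_ (mul_volume_le_partitionFn (F := F) p β B (n * (β * a ^ 2) - 2 * β * a) hFm
    (fun f hf => ?_) (fun f hf => ?_))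
  · rw [hv, ← ENNReal.ofReal_mul (Real.exp_pos _).le]
    apply ENNReal.ofReal_le_ofReal
    have h1 : 0 < 1 - a / B := by rw [sub_pos, div_lt_one hB]; exact haB
    have e1 : Real.exp (n * Real.log (1 - a / B)) = (1 - a / B) ^ (M + 1) := by
      rw [hnn, Real.exp_nat_mul, Real.exp_log h1, hM]
    have e2 : n * (β * a ^ 2 + Real.log (1 - a / B)) -
        (2 * β * a + |β| * gradBound G.maxDegree B p n + Real.log B) =
        (n * (β * a ^ 2) - 2 * β * a - |β| * gradBound G.maxDegree B p n) +
          n * Real.log (1 - a / B) - Real.log B := by ring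
    rw [e2, Real.exp_sub _ (Real.log B), Real.exp_log hB, Real.exp_add, e1, ← hnn, hM,
      Nat.add_sub_cancel]
    have e3 : ballVolume (M + 1) (B * n) * (1 - a / B) ^ (M + 1) / B =
        Real.pi * ballVolume M ((B - a) * n) * ((B - a) / B) := by
      have e4 : n = (M : ℝ) + 1 := by rw [hnn, hM]; push_cast; ring
      have e5 : (1 - a / B) = (B - a) / B := by field_simp
      have e6 : (M.factorial : ℝ) ≠ 0 := by positivity
      unfold ballVolume
      rw [e5, Nat.factorial_succ, mul_pow, mul_pow, mul_pow, mul_pow, div_pow, pow_succ, pow_succ,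
        pow_succ, pow_succ]
      push_cast
      rw [← e4]
      field_simp
    have h2 : (B - a) / B ≤ 1 := by rw [div_le_one hB]; linarith
    have h3 : 0 ≤ Real.pi * ballVolume M ((B - a) * n) :=
      mul_nonneg hpi.le (ballVolume_nonneg _ (mul_nonneg (by linarith) hn0.le))
    have h4 : ballVolume (M + 1) (B * n) * (1 - a / B) ^ (M + 1) / B ≤
        Real.pi * ballVolume M ((B - a) * n) := by
      rw [e3]
      exact mul_le_of_le_one_right h3 h2
    refine le_of_eq_of_le ?_ (mul_le_mul_of_nonneg_left h4 (Real.exp_pos _).le)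
    ring
  · have := hf.2
    have := hf.1.2
    linarith
  · have h1 : (a * n - 1) ^ 2 ≤ quartic f := by
      have h2 : ‖f x₀‖ ^ 4 ≤ quartic f :=
        Finset.single_le_sum (f := fun x => ‖f x‖ ^ 4) (fun _ _ => by positivity)
          (Finset.mem_univ x₀)
      have h3 : (a * n - 1) ^ 2 ≤ (‖f x₀‖ ^ 2) ^ 2 :=
        pow_le_pow_left₀ (by linarith) hf.1.1.le 2
      calc _ ≤ _ := h3
        _ = ‖f x₀‖ ^ 4 := by ring
        _ ≤ _ := h2
    have h4 : n * a ^ 2 - 2 * a ≤ quartic f / n := by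
      rw [le_div_iff₀ hn0]
      nlinarith
    have := mul_le_mul_of_nonneg_left h4 hβ
    linarith

end Gibbs

/-! ### Typical configurations -/

section Typical

variable {V : Type*} [Fintype V]

/-- The mass of the big sites as a fraction of the maximal mass `B n`. -/
noncomputable def massFrac (B : ℝ) (f : V → ℂ) : ℝ := bigMass f / (B * Fintype.card V)

/-- The quartic sum over the big sites, normalised so that it is at most `massFrac B f ^ 2`, with
equality if there is a single big site. -/
noncomputable def quarticFrac (B : ℝ) (f : V → ℂ) : ℝ :=
  bigQuartic f / (B * Fintype.card V) ^ 2

/-- The configurations with mass above `B n - t` for which the exponent of the upper bound is within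
`κ t` of its maximum `n g`; here `b` is the positive part of `β`. -/
def Typical (b B g κ t : ℝ) (f : V → ℂ) : Prop :=
  B * Fintype.card V - t < power f ∧
    B * Fintype.card V * Real.exp (g - κ * (t / Fintype.card V)) <
      (B * Fintype.card V - bigMass f) *
        Real.exp (b * bigQuartic f / (Fintype.card V : ℝ) ^ 2)

theorem massFrac_nonneg {B : ℝ} (hB : 0 < B) (f : V → ℂ) : 0 ≤ massFrac B f :=
  div_nonneg (bigMass_nonneg f) (by positivity)

theorem quarticFrac_le (B : ℝ) (f : V → ℂ) : quarticFrac B f ≤ massFrac B f ^ 2 := by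
  unfold quarticFrac massFrac
  rw [div_pow]
  gcongr
  exact bigQuartic_le f

variable [Nonempty V]

theorem bigMass_eq {B : ℝ} (hB : 0 < B) (f : V → ℂ) :
    bigMass f = B * Fintype.card V * massFrac B f := by
  have hn0 : (0 : ℝ) < Fintype.card V := by exact_mod_cast Fintype.card_pos
  unfold massFrac
  field_simp

theorem mul_bigQuartic_div_eq {b B : ℝ} (hB : 0 < B) (f : V → ℂ) :
    b * bigQuartic f / (Fintype.card V : ℝ) ^ 2 = b * B ^ 2 * quarticFrac B f := by
  have hn0 : (0 : ℝ) < Fintype.card V := by exact_mod_cast Fintype.card_pos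
  unfold quarticFrac
  field_simp

theorem massFrac_le_one {B : ℝ} (hB : 0 < B) {f : V → ℂ}
    (hf : power f ≤ B * Fintype.card V) : massFrac B f ≤ 1 := by
  have hn0 : (0 : ℝ) < Fintype.card V := by exact_mod_cast Fintype.card_pos
  exact (div_le_one (by positivity)).2 ((bigMass_le_power f).trans hf)

/-- For a typical configuration the two deficits, that of the rate and that from mass being spread
over several big sites, add up to less than `κ t / n`. -/
theorem Typical.lt_rate {b B g κ t : ℝ} (hB : 0 < B) {f : V → ℂ} (h : Typical b B g κ t f) :
    massFrac B f < 1 ∧ b * B ^ 2 * (massFrac B f ^ 2 - quarticFrac B f) <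
      rate (b * B ^ 2) (massFrac B f) - g + κ * (t / Fintype.card V) := by
  have hn0 : (0 : ℝ) < Fintype.card V := by exact_mod_cast Fintype.card_pos
  have h2 := h.2
  rw [mul_bigQuartic_div_eq hB, bigMass_eq hB] at h2
  set u := massFrac B f
  have e : B * (Fintype.card V : ℝ) - B * Fintype.card V * u =
      B * Fintype.card V * (1 - u) := by ring
  rw [e, mul_assoc _ (1 - u)] at h2
  have h3 := lt_of_mul_lt_mul_left h2 (by positivity)
  have hu : 0 < 1 - u :=
    pos_of_mul_pos_left ((Real.exp_pos _).trans h3) (Real.exp_pos _).le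
  rw [← Real.exp_log hu, ← Real.exp_add, Real.exp_lt_exp] at h3
  refine ⟨by linarith, ?_⟩
  unfold rate
  linarith

theorem sub_bigMass_mul_exp_le {b B g : ℝ} (hb : 0 ≤ b) (hB : 0 < B)
    (hrate : ∀ u, 0 ≤ u → u < 1 → rate (b * B ^ 2) u ≤ g) {f : V → ℂ}
    (hf : power f ≤ B * Fintype.card V) :
    (B * Fintype.card V - bigMass f) * Real.exp (b * bigQuartic f / (Fintype.card V : ℝ) ^ 2) ≤
      B * Fintype.card V * Real.exp g := by
  have hn0 : (0 : ℝ) < Fintype.card V := by exact_mod_cast Fintype.card_pos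
  have hq := quarticFrac_le B f
  have hu0 := massFrac_nonneg hB f
  have hu1 := massFrac_le_one hB hf
  rw [mul_bigQuartic_div_eq hB, bigMass_eq hB]
  set u := massFrac B f
  have e : B * (Fintype.card V : ℝ) - B * Fintype.card V * u =
      B * Fintype.card V * (1 - u) := by ring
  rw [e, mul_assoc _ (1 - u)]
  refine mul_le_mul_of_nonneg_left ?_ (by positivity)
  rcases hu1.eq_or_lt with h | h
  · rw [h, sub_self, zero_mul]; exact (Real.exp_pos _).le
  · have hu : 0 < 1 - u := by linarith
    rw [← Real.exp_log hu, ← Real.exp_add, Real.exp_le_exp]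
    have h1 := hrate u hu0 h
    have h2 : b * B ^ 2 * quarticFrac B f ≤ b * B ^ 2 * u ^ 2 := by gcongr
    unfold rate at h1
    linarith

variable [DecidableEq V] {G : SimpleGraph V} [DecidableRel G.Adj]

theorem gibbsWeight_not_typical_le {p β B g κ t : ℝ} (hB : 0 < B) (hg : 0 ≤ g) (hκ : 0 ≤ κ)
    (ht : 0 ≤ t) (hn : B * √(Fintype.card V : ℝ) ≤ (Fintype.card V : ℝ) / 2)
    (hrate : ∀ u, 0 ≤ u → u < 1 → rate (max β 0 * B ^ 2) u ≤ g) :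
    gibbsWeight G (spacing V p) β B
        {f | power f ≤ B * Fintype.card V ∧ ¬Typical (max β 0) B g κ t f} ≤
      ENNReal.ofReal (ballVolume (Fintype.card V) (B * Fintype.card V) *
        (2 * Real.exp (|β| * gradBound G.maxDegree B p (Fintype.card V) + Fintype.card V * g +
          entropyErr (max β 0) B (Fintype.card V) - min κ B⁻¹ * t / 2))) := by
  have hn0 : (0 : ℝ) < Fintype.card V := by exact_mod_cast Fintype.card_pos
  set n : ℝ := (Fintype.card V : ℝ) with hnn
  have hb : 0 ≤ max β 0 := le_max_right _ _
  set b := max β 0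
  set W := ballVolume (Fintype.card V) (B * n) with hW
  have hW0 : 0 ≤ W := ballVolume_nonneg _ (by positivity)
  set m := min κ B⁻¹ with hm
  let E₁ : Set (V → ℂ) := {f | power f ≤ B * n - t}
  let E₂ : Set (V → ℂ) := {f | power f ≤ B * n ∧
    (B * n - bigMass f) * Real.exp (b * bigQuartic f / n ^ 2) ≤
      B * n * Real.exp (g - κ * (t / n))}
  have hsub : {f : V → ℂ | power f ≤ B * n ∧ ¬Typical b B g κ t f} ⊆ E₁ ∪ E₂ := by
    rintro f ⟨hf, hT⟩
    by_cases h : power f ≤ B * n - t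
    · exact Or.inl h
    · refine Or.inr ⟨hf, ?_⟩
      by_contra h2
      exact hT ⟨not_le.1 h, not_le.1 h2⟩
  set X := Real.exp (n * g + entropyErr b B n - m * t / 2) with hX
  have hI : ∀ (E : Set (V → ℂ)) (R d : ℝ), R ≤ B * n → 0 ≤ d → m * t ≤ n * d →
      (∀ f ∈ E, power f ≤ R ∧ (R - bigMass f) * Real.exp (b * bigQuartic f / n ^ 2) ≤
        B * n * Real.exp (g - d)) →
      gibbsWeight G (spacing V p) β B E ≤
        ENNReal.ofReal (Real.exp (|β| * gradBound G.maxDegree B p n) * (W * X)) := by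
    intro E R d hR hd hmd hE
    refine (gibbsWeight_le p β B fun f hf => (hE f hf).1.trans hR).trans ?_
    rw [ENNReal.ofReal_mul (Real.exp_pos _).le]
    refine mul_le_mul_right ((lintegral_exp_quartic_le hb hB hR hg hd hn hE).trans ?_) _
    apply ENNReal.ofReal_le_ofReal
    refine mul_le_mul_of_nonneg_left (Real.exp_le_exp.2 ?_) hW0
    linarith
  have h1 := hI E₁ (B * n - t) (t / (B * n)) (by linarith) (by positivity) (by
      have : n * (t / (B * n)) = B⁻¹ * t := by field_simp
      rw [this]
      exact mul_le_mul_of_nonneg_right (min_le_right _ _) ht) (by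
      intro f hf
      have hf' : power f ≤ B * n - t := hf
      refine ⟨hf', ?_⟩
      have hfB : power f ≤ B * n := by linarith
      have h0 : 0 ≤ B * n - bigMass f := sub_nonneg.2 ((bigMass_le_power f).trans hfB)
      -- `1 - δ - u ≤ (1 - δ) (1 - u) ≤ exp (-δ) (1 - u)` with `δ = t / (B n)`
      have e1 : B * n - t - bigMass f ≤ Real.exp (-(t / (B * n))) * (B * n - bigMass f) := by
        have h3 := mul_le_mul_of_nonneg_right (Real.add_one_le_exp (-(t / (B * n)))) h0
        have h4 : (-(t / (B * n)) + 1) * (B * n - bigMass f) =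
            B * n - t - bigMass f + t / (B * n) * bigMass f := by
          field_simp
          ring
        have h5 : 0 ≤ t / (B * n) * bigMass f := mul_nonneg (by positivity) (bigMass_nonneg f)
        linarith
      calc _ ≤ Real.exp (-(t / (B * n))) * (B * n - bigMass f) *
              Real.exp (b * bigQuartic f / n ^ 2) := by gcongr
        _ = Real.exp (-(t / (B * n))) * ((B * n - bigMass f) *
              Real.exp (b * bigQuartic f / n ^ 2)) := by ring
        _ ≤ Real.exp (-(t / (B * n))) * (B * n * Real.exp g) :=
            mul_le_mul_of_nonneg_left (sub_bigMass_mul_exp_le hb hB hrate hfB) (Real.exp_pos _).le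
        _ = _ := by rw [sub_eq_add_neg, Real.exp_add]; ring)
  have h2 := hI E₂ (B * n) (κ * (t / n)) le_rfl (by positivity) (by
      have : n * (κ * (t / n)) = κ * t := by field_simp
      rw [this]
      exact mul_le_mul_of_nonneg_right (min_le_left _ _) ht) (fun f hf => hf)
  refine (measure_mono hsub).trans ((measure_union_le _ _).trans ((add_le_add h1 h2).trans ?_))
  rw [← ENNReal.ofReal_add (by positivity) (by positivity)]
  apply ENNReal.ofReal_le_ofReal
  have e : |β| * gradBound G.maxDegree B p n + n * g + entropyErr b B n - m * t / 2 =
      |β| * gradBound G.maxDegree B p n + (n * g + entropyErr b B n - m * t / 2) := by ring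
  rw [e, Real.exp_add]
  apply le_of_eq
  ring

theorem partitionFn_ne_top {p β B : ℝ} (hB : 0 < B)
    (hn : B * √(Fintype.card V : ℝ) ≤ (Fintype.card V : ℝ) / 2) {g : ℝ} (hg : 0 ≤ g)
    (hrate : ∀ u, 0 ≤ u → u < 1 → rate (max β 0 * B ^ 2) u ≤ g) :
    partitionFn G (spacing V p) β B ≠ ⊤ := by
  have hb : 0 ≤ max β 0 := le_max_right _ _
  let E : Set (V → ℂ) := {f | power f ≤ B * Fintype.card V}
  have h1 : partitionFn G (spacing V p) β B ≤ gibbsWeight G (spacing V p) β B E := by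
    rw [partitionFn, gibbsWeight_apply, gibbsWeight_apply]
    exact lintegral_mono_set fun f hf => ⟨hf.2, hf.2⟩
  refine ne_top_of_le_ne_top ?_ (h1.trans (gibbsWeight_le p β B fun f hf => hf))
  refine ENNReal.mul_ne_top ENNReal.ofReal_ne_top (ne_top_of_le_ne_top ENNReal.ofReal_ne_top
    (lintegral_exp_quartic_le (R := B * Fintype.card V) (d := 0) hb hB le_rfl hg le_rfl hn
      fun f hf => ⟨hf, ?_⟩))
  rw [sub_zero]
  exact sub_bigMass_mul_exp_le hb hB hrate hf

/-- If the partition function attains the exponent `n g` up to `ζ`, then an event that contains the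
typical configurations of the ball has probability close to `1`. -/
theorem gibbs_real_ge {p β B g κ t ζ : ℝ} (hB : 0 < B) (hg : 0 ≤ g) (hκ : 0 ≤ κ)
    (ht : 0 ≤ t) (hn : B * √(Fintype.card V : ℝ) ≤ (Fintype.card V : ℝ) / 2)
    (hrate : ∀ u, 0 ≤ u → u < 1 → rate (max β 0 * B ^ 2) u ≤ g)
    (hZ : ENNReal.ofReal (ballVolume (Fintype.card V) (B * Fintype.card V) *
      Real.exp (Fintype.card V * g - ζ)) ≤ partitionFn G (spacing V p) β B)
    {A : Set (V → ℂ)}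
    (hA : ∀ f, power f ≤ B * Fintype.card V → Typical (max β 0) B g κ t f → f ∈ A) :
    1 - 2 * Real.exp (ζ + |β| * gradBound G.maxDegree B p (Fintype.card V) +
        entropyErr (max β 0) B (Fintype.card V) - min κ B⁻¹ * t / 2) ≤
      (gibbs G (spacing V p) β B).real A := by
  have hn0 : (0 : ℝ) < Fintype.card V := by exact_mod_cast Fintype.card_pos
  set r := 2 * Real.exp (ζ + |β| * gradBound G.maxDegree B p (Fintype.card V) +
        entropyErr (max β 0) B (Fintype.card V) - min κ B⁻¹ * t / 2) with hr
  set Z := partitionFn G (spacing V p) β B with hZdef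
  have hW : 0 < ballVolume (Fintype.card V) (B * Fintype.card V) :=
    ballVolume_pos _ (by positivity)
  have hZ0 : Z ≠ 0 := fun h => by
    rw [h, nonpos_iff_eq_zero, ENNReal.ofReal_eq_zero] at hZ
    exact absurd hZ (not_le.2 (by positivity))
  have hZt : Z ≠ ⊤ := partitionFn_ne_top hB hn hg hrate
  let Bad : Set (V → ℂ) := {f | power f ≤ B * Fintype.card V ∧ ¬Typical (max β 0) B g κ t f}
  let Out : Set (V → ℂ) := {f | ¬power f ≤ B * Fintype.card V}
  have huniv : gibbs G (spacing V p) β B Set.univ = 1 := by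
    rw [gibbs, Measure.smul_apply, smul_eq_mul]
    exact ENNReal.inv_mul_cancel hZ0 hZt
  have hprob : IsProbabilityMeasure (gibbs G (spacing V p) β B) := ⟨huniv⟩
  have hOut : gibbs G (spacing V p) β B Out = 0 := by
    have h : Out ∩ {f | power f ≤ B * Fintype.card V} = ∅ := by
      ext f; exact ⟨fun hf => hf.1 hf.2, fun hf => hf.elim⟩
    rw [gibbs, Measure.smul_apply, gibbsWeight_apply, h]
    simp
  have hBad : gibbs G (spacing V p) β B Bad ≤ ENNReal.ofReal r := by
    rw [gibbs, Measure.smul_apply, smul_eq_mul, mul_comm, ← div_eq_mul_inv,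
      ENNReal.div_le_iff hZ0 hZt]
    refine (gibbsWeight_not_typical_le hB hg hκ ht hn hrate).trans ?_
    refine le_trans ?_ (mul_le_mul_right hZ _)
    rw [← ENNReal.ofReal_mul (by positivity)]
    apply ENNReal.ofReal_le_ofReal
    rw [hr]
    have e : |β| * gradBound G.maxDegree B p (Fintype.card V) + Fintype.card V * g +
          entropyErr (max β 0) B (Fintype.card V) - min κ B⁻¹ * t / 2 =
        (ζ + |β| * gradBound G.maxDegree B p (Fintype.card V) +
          entropyErr (max β 0) B (Fintype.card V) - min κ B⁻¹ * t / 2) +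
          (Fintype.card V * g - ζ) := by ring
    rw [e, Real.exp_add]
    apply le_of_eq
    ring
  have hcov : (Set.univ : Set (V → ℂ)) ⊆ A ∪ (Bad ∪ Out) := by
    intro f _
    by_cases h1 : power f ≤ B * Fintype.card V
    · by_cases h2 : Typical (max β 0) B g κ t f
      · exact Or.inl (hA f h1 h2)
      · exact Or.inr (Or.inl ⟨h1, h2⟩)
    · exact Or.inr (Or.inr h1)
  have h1 : (gibbs G (spacing V p) β B).real Set.univ ≤
      (gibbs G (spacing V p) β B).real A + ((gibbs G (spacing V p) β B).real Bad +
        (gibbs G (spacing V p) β B).real Out) :=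
    (measureReal_mono hcov).trans ((measureReal_union_le _ _).trans
      (add_le_add le_rfl (measureReal_union_le _ _)))
  have h2 : (gibbs G (spacing V p) β B).real Bad ≤ r :=
    ENNReal.toReal_le_of_le_ofReal (by positivity) hBad
  have h3 : (gibbs G (spacing V p) β B).real Out = 0 := by
    rw [Measure.real, hOut, ENNReal.toReal_zero]
  rw [probReal_univ, h3] at h1
  linarith

end Typical

/-! ### The largest components -/

section Deterministic

variable {V : Type*} [Fintype V]

theorem exists_norm_sq_eq_M₁ [Nonempty V] (f : V → ℂ) : ∃ x, ‖f x‖ ^ 2 = M₁ f :=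
  exists_eq_ciSup_of_finite (f := fun x => ‖f x‖ ^ 2)

theorem norm_sq_le_M₁ (f : V → ℂ) (x : V) : ‖f x‖ ^ 2 ≤ M₁ f :=
  le_ciSup (f := fun x => ‖f x‖ ^ 2) (Set.finite_range _).bddAbove x

theorem sqrt_card_lt_M₁ (f : V → ℂ) (h : 0 < bigMass f) : √(Fintype.card V : ℝ) < M₁ f := by
  have hne : (bigSites f).Nonempty := by
    rw [Finset.nonempty_iff_ne_empty]
    intro h0
    rw [bigMass, h0, Finset.sum_empty] at h
    exact lt_irrefl _ h
  obtain ⟨x, hx⟩ := hne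
  exact (mem_bigSites.1 hx).trans_le (norm_sq_le_M₁ f x)

theorem M₁_le_of_bigMass_le [Nonempty V] {f : V → ℂ} {t : ℝ} (ht : √(Fintype.card V : ℝ) ≤ t)
    (h : bigMass f ≤ t) : M₁ f ≤ t := by
  obtain ⟨x, hx⟩ := exists_norm_sq_eq_M₁ f
  rw [← hx]
  by_cases hxb : x ∈ bigSites f
  · exact (Finset.single_le_sum (f := fun x => ‖f x‖ ^ 2) (fun _ _ => by positivity) hxb).trans h
  · exact (not_lt.1 (mt mem_bigSites.2 hxb)).trans ht

theorem M₁_le_bigMass [Nonempty V] {f : V → ℂ} (h : 0 < bigMass f) : M₁ f ≤ bigMass f := by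
  obtain ⟨x, hx⟩ := exists_norm_sq_eq_M₁ f
  have hb : x ∈ bigSites f := mem_bigSites.2 (hx ▸ sqrt_card_lt_M₁ f h)
  rw [← hx]
  exact Finset.single_le_sum (f := fun x => ‖f x‖ ^ 2) (fun _ _ => by positivity) hb

theorem bigQuartic_le_M₁_mul (f : V → ℂ) : bigQuartic f ≤ M₁ f * bigMass f := by
  unfold bigQuartic bigMass
  rw [Finset.mul_sum]
  refine Finset.sum_le_sum fun x _ => ?_
  have : ‖f x‖ ^ 4 = ‖f x‖ ^ 2 * ‖f x‖ ^ 2 := by ring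
  rw [this]
  gcongr
  exact norm_sq_le_M₁ f x

/-- The largest component and any other big component both count in `bigMass f`. -/
theorem M₂_le [Nonempty V] {f : V → ℂ} (h : 0 < bigMass f) :
    M₂ f ≤ max (√(Fintype.card V : ℝ)) (bigMass f - M₁ f) := by
  classical
  obtain ⟨x, hx⟩ := exists_norm_sq_eq_M₁ f
  have hb : x ∈ bigSites f := mem_bigSites.2 (hx ▸ sqrt_card_lt_M₁ f h)
  refine (ciInf_le (Set.finite_range _).bddBelow x).trans ?_
  refine Real.iSup_le (fun y => ?_) (le_max_of_le_left (Real.sqrt_nonneg _))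
  by_cases hy : (y : V) ∈ bigSites f
  · refine le_max_of_le_right ?_
    have h1 : ∑ z ∈ {x, (y : V)}, ‖f z‖ ^ 2 ≤ bigMass f :=
      Finset.sum_le_sum_of_subset_of_nonneg (by
        intro z hz
        rw [Finset.mem_insert, Finset.mem_singleton] at hz
        rcases hz with rfl | rfl
        · exact hb
        · exact hy) fun _ _ _ => by positivity
    rw [Finset.sum_pair (Ne.symm y.2)] at h1
    linarith
  · exact le_max_of_le_left (not_lt.1 (mt mem_bigSites.2 hy))

end Deterministic

/-! ### From the mass on big sites to the two regimes -/

section Regimes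

variable {V : Type*} [Fintype V] [Nonempty V] [DecidableEq V] {G : SimpleGraph V}
  [DecidableRel G.Adj]

theorem Delocalized.of_bigMass_le {p B q : ℝ} {f : V → ℂ}
    (hf : power f ≤ B * Fintype.card V)
    (hlow : B * Fintype.card V - (Fintype.card V : ℝ) ^ q < power f)
    (hm : bigMass f ≤ (Fintype.card V : ℝ) ^ q / 2)
    (ht : B * (Fintype.card V : ℝ) * √(Fintype.card V : ℝ) ≤ ((Fintype.card V : ℝ) ^ q) ^ 2 / 2)
    (hs : √(Fintype.card V : ℝ) ≤ (Fintype.card V : ℝ) ^ q)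
    (hG : gradBound G.maxDegree B p (Fintype.card V) ≤
      ((Fintype.card V : ℝ) ^ q) ^ 2 / Fintype.card V) :
    Delocalized G (spacing V p) B q f := by
  have hn0 : (0 : ℝ) < Fintype.card V := by exact_mod_cast Fintype.card_pos
  have hS := quartic_le_of_bigMass_le hf hm ht
  have hS0 : 0 ≤ quartic f := Finset.sum_nonneg fun _ _ => by positivity
  have hH0 := hamiltonian_add_nonneg (G := G) (spacing V p) f
  have hH1 := hamiltonian_add_le (G := G) (p := p) hf
  set n : ℝ := (Fintype.card V : ℝ) with hn
  have e1 : n ^ (-(1 - q)) = n ^ q / n := by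
    rw [neg_sub, Real.rpow_sub hn0, Real.rpow_one]
  have e2 : n ^ (-2 * (1 - q)) = (n ^ q) ^ 2 / n / n := by
    rw [show -2 * (1 - q) = -(1 - q) + -(1 - q) by ring, Real.rpow_add hn0, e1]
    field_simp
  have ht0 : 0 < n ^ q := Real.rpow_pos_of_pos hn0 q
  unfold Delocalized
  simp only [← hn, e1, e2]
  refine ⟨?_, ?_, ?_⟩
  · rw [abs_div, abs_of_pos hn0, mul_div_assoc', div_le_div_iff_of_pos_right hn0, abs_le]
    have h1 : quartic f / n ≤ (n ^ q) ^ 2 / n := by gcongr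
    have h2 : 0 ≤ quartic f / n := by positivity
    constructor <;> linarith
  · have : power f / n - B = (power f - B * n) / n := by field_simp
    rw [this, abs_div, abs_of_pos hn0, div_le_div_iff_of_pos_right hn0, abs_le]
    constructor <;> linarith
  · rw [div_le_div_iff_of_pos_right hn0]
    exact M₁_le_of_bigMass_le hs (hm.trans (by linarith))

set_option maxHeartbeats 1000000 in
/-- With `s = n ^ (-(1 - q) / 4)`, all errors are multiples of `s`, `s ^ 2` or `s ^ 4`. As
`bigQuartic f ≤ M₁ f * bigMass f`, a `bigQuartic f` close to `bigMass f ^ 2` forces the largest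
component to carry nearly all of `bigMass f`. -/
theorem Localized.of_massFrac_near {p β B q K₁ K₂ : ℝ} (hB : 0 < B) (hq : q < 1) (hK₁ : 0 ≤ K₁)
    (hK₂ : 0 ≤ K₂) (hθ : 2 < β * B ^ 2) {f : V → ℂ}
    (hf : power f ≤ B * Fintype.card V)
    (hlow : B * Fintype.card V - (Fintype.card V : ℝ) ^ q < power f)
    (hu : |massFrac B f - optFrac (β * B ^ 2)| ≤ K₁ * (Fintype.card V : ℝ) ^ (-(1 - q) / 2))
    (hQ : massFrac B f ^ 2 - quarticFrac B f ≤ K₂ * (Fintype.card V : ℝ) ^ (-(1 - q)))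
    (hsmall : K₁ * (Fintype.card V : ℝ) ^ (-(1 - q) / 2) ≤ 1 / 4)
    (hs : √(Fintype.card V : ℝ) ≤ (Fintype.card V : ℝ) ^ q)
    (hG : gradBound G.maxDegree B p (Fintype.card V) ≤
      4 * G.maxDegree * B * (Fintype.card V : ℝ) ^ q) :
    Localized G (spacing V p) β B q (1 + 4 * G.maxDegree * B + B + 4 * B * K₂ + B * K₁ +
      B ^ 2 * K₂ + 2 * B ^ 2 * K₁) f := by
  have hn0 : (0 : ℝ) < Fintype.card V := by exact_mod_cast Fintype.card_pos
  have hn1 : (1 : ℝ) ≤ Fintype.card V := by exact_mod_cast Fintype.card_pos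
  have hw := half_lt_optFrac hθ
  have hw1 := optFrac_lt_one hθ.le
  have hu1 := massFrac_le_one hB hf
  have hq2 := quarticFrac_le B f
  have hH0 := hamiltonian_add_nonneg (G := G) (spacing V p) f
  have hH1 := hamiltonian_add_le (G := G) (p := p) hf
  have hSQ := quartic_le f
  have hQS := bigQuartic_le_quartic f
  have hbm := bigMass_eq hB f
  have hbq : bigQuartic f = (B * Fintype.card V) ^ 2 * quarticFrac B f := by
    unfold quarticFrac; field_simp
  have hM₂ := M₂_le (f := f)
  have hM₁ := M₁_le_bigMass (f := f)
  have hMQ := bigQuartic_le_M₁_mul f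
  have hc := condMass_eq β B
  set n : ℝ := (Fintype.card V : ℝ) with hn
  set w := optFrac (β * B ^ 2)
  set u := massFrac B f
  set v := quarticFrac B f
  set s := n ^ (-(1 - q) / 4) with hsdef
  have hs0 : 0 < s := Real.rpow_pos_of_pos hn0 _
  have hs1 : s ≤ 1 := Real.rpow_le_one_of_one_le_of_nonpos hn1 (by linarith)
  have e2 : n ^ (-(1 - q) / 2) = s ^ 2 := by
    rw [hsdef, ← Real.rpow_natCast, ← Real.rpow_mul hn0.le]; congr 1; push_cast; ring
  have e4 : n ^ (-(1 - q)) = s ^ 4 := by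
    rw [hsdef, ← Real.rpow_natCast, ← Real.rpow_mul hn0.le]; congr 1; push_cast; ring
  have et : n ^ q = n * s ^ 4 := by
    rw [← e4, neg_sub, Real.rpow_sub hn0, Real.rpow_one]; field_simp
  rw [e2] at hu hsmall
  rw [e4] at hQ
  rw [et] at hlow hs hG
  have h2s : s ^ 2 ≤ s := pow_le_of_le_one hs0.le hs1 two_ne_zero
  have h42 : s ^ 4 ≤ s ^ 2 := pow_le_pow_of_le_one hs0.le hs1 (by norm_num)
  have h4s : s ^ 4 ≤ s := h42.trans h2s
  obtain ⟨hua, hub⟩ := abs_le.1 hu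
  have hu4 : 1 / 4 ≤ u := by linarith
  have hpos : 0 < bigMass f := by rw [hbm]; positivity
  -- `z` is the largest component as a fraction of `B n`
  obtain ⟨z, hz⟩ : ∃ z, M₁ f = B * n * z := ⟨M₁ f / (B * n), by field_simp⟩
  have hM₁' := hM₁ hpos
  have hM₂' := hM₂ hpos
  rw [hz, hbm] at hM₁' hM₂'
  rw [hz, hbm, hbq] at hMQ
  have hBn : 0 < B * n := by positivity
  have hzu : z ≤ u := le_of_mul_le_mul_left hM₁' hBn
  have hvz : v ≤ z * u := by
    have : (B * n) ^ 2 * v ≤ (B * n) ^ 2 * (z * u) := by linarith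
    exact le_of_mul_le_mul_left this (by positivity)
  have huz : u - z ≤ 4 * K₂ * s ^ 4 := by
    have h0 : u * (u - z) = u ^ 2 - z * u := by ring
    have h1 : u * (u - z) ≤ K₂ * s ^ 4 := by linarith
    have h2 : 1 / 4 * (u - z) ≤ u * (u - z) :=
      mul_le_mul_of_nonneg_right hu4 (sub_nonneg.2 hzu)
    linarith
  have hK1s : 0 ≤ K₁ * s := by positivity
  have hK2s : 0 ≤ K₂ * s := by positivity
  have hK1s2 : K₁ * s ^ 2 ≤ K₁ * s := by gcongr
  have hK2s4 : K₂ * s ^ 4 ≤ K₂ * s := by gcongr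
  have hDs : 0 ≤ 4 * G.maxDegree * B * s := by positivity
  have hD0 : 0 ≤ 4 * (G.maxDegree : ℝ) * B := by positivity
  have hC1 : 1 ≤ 1 + 4 * G.maxDegree * B + B + 4 * B * K₂ + B * K₁ + B ^ 2 * K₂ +
      2 * B ^ 2 * K₁ := by
    have : 0 ≤ 4 * G.maxDegree * B + B + 4 * B * K₂ + B * K₁ + B ^ 2 * K₂ + 2 * B ^ 2 * K₁ := by
      positivity
    linarith
  set C := 1 + 4 * G.maxDegree * B + B + 4 * B * K₂ + B * K₁ + B ^ 2 * K₂ + 2 * B ^ 2 * K₁ with hC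
  unfold Localized
  simp only [← hn, e2, e4, hc]
  refine ⟨?_, ?_, ?_, ?_⟩
  · obtain ⟨y, hy⟩ : ∃ y, quartic f = n ^ 2 * y := ⟨quartic f / n ^ 2, by field_simp⟩
    obtain ⟨H, hH⟩ : ∃ H, hamiltonian G (spacing V p) f = n * H :=
      ⟨hamiltonian G (spacing V p) f / n, by field_simp⟩
    rw [hy, hbq] at hSQ hQS
    rw [hH, hy] at hH0 hH1
    have e5 : n * H + n ^ 2 * y / n = n * (H + y) := by field_simp
    rw [e5] at hH0 hH1
    have hy1 : B ^ 2 * v ≤ y := by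
      have : n ^ 2 * (B ^ 2 * v) ≤ n ^ 2 * y := by linarith
      exact le_of_mul_le_mul_left this (by positivity)
    have hy2 : y ≤ B ^ 2 * v + B * s ^ 4 := by
      have h1 : √n * power f ≤ n * s ^ 4 * (B * n) := by
        have := power_nonneg f
        gcongr
      have : n ^ 2 * y ≤ n ^ 2 * (B ^ 2 * v + B * s ^ 4) := by linarith
      exact le_of_mul_le_mul_left this (by positivity)
    have hH2 : H + y ≤ 4 * G.maxDegree * B * s ^ 4 := by
      have : n * (H + y) ≤ n * (4 * G.maxDegree * B * s ^ 4) := by linarith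
      exact le_of_mul_le_mul_left this hn0
    have hH3 : 0 ≤ H + y := (mul_nonneg_iff_of_pos_left hn0).1 hH0
    have hu2 : |u ^ 2 - w ^ 2| ≤ 2 * (K₁ * s ^ 2) := by
      have : u ^ 2 - w ^ 2 = (u - w) * (u + w) := by ring
      rw [this, abs_mul, abs_of_nonneg (by linarith : 0 ≤ u + w)]
      have : |u - w| * (u + w) ≤ K₁ * s ^ 2 * 2 := by
        gcongr
        linarith
      linarith
    obtain ⟨hu2a, hu2b⟩ := abs_le.1 hu2
    have hH' : n * H / n = H := by field_simp
    rw [hH, hH', abs_le]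
    have hB2 : 0 < B ^ 2 := by positivity
    have b1 : B ^ 2 * (u ^ 2 - v) ≤ B ^ 2 * (K₂ * s) :=
      mul_le_mul_of_nonneg_left (hQ.trans hK2s4) hB2.le
    have b2 : B ^ 2 * (u ^ 2 - w ^ 2) ≤ B ^ 2 * (2 * (K₁ * s)) :=
      mul_le_mul_of_nonneg_left (by linarith) hB2.le
    have b3 : B ^ 2 * -(2 * (K₁ * s)) ≤ B ^ 2 * (u ^ 2 - w ^ 2) :=
      mul_le_mul_of_nonneg_left (by linarith) hB2.le
    have b4 : 0 ≤ B ^ 2 * (u ^ 2 - v) := mul_nonneg hB2.le (by linarith)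
    have b5 : B * s ^ 4 ≤ B * s := by gcongr
    have b6 : 4 * G.maxDegree * B * s ^ 4 ≤ 4 * G.maxDegree * B * s := by gcongr
    have b7 : 0 ≤ B * (K₂ * s) := by positivity
    have b8 : 0 ≤ B * (K₁ * s) := by positivity
    have b9 : 0 ≤ B * s := by positivity
    have b10 : 0 ≤ B ^ 2 * (K₂ * s) := by positivity
    have b11 : 0 ≤ B ^ 2 * (K₁ * s) := by positivity
    have eC : C * s = s + 4 * G.maxDegree * B * s + B * s + 4 * (B * (K₂ * s)) + B * (K₁ * s) +
      B ^ 2 * (K₂ * s) + 2 * (B ^ 2 * (K₁ * s)) := by rw [hC]; ring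
    rw [eC, mul_pow]
    constructor <;> linarith
  · have h1 : power f / n - B = (power f - B * n) / n := by field_simp
    have h2 : |power f / n - B| ≤ s ^ 4 := by
      rw [h1, abs_div, abs_of_pos hn0, div_le_iff₀ hn0, abs_le]
      have := mul_pos hn0 (pow_pos hs0 4)
      constructor <;> linarith
    refine h2.trans (h42.trans ?_)
    exact le_mul_of_one_le_left (sq_nonneg s) hC1
  · have h1 : B * n * z / n = B * z := by field_simp
    rw [hz, h1, ← mul_sub, abs_mul, abs_of_pos hB]
    have h2 : |z - w| ≤ 4 * (K₂ * s) + K₁ * s := by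
      rw [abs_le]
      constructor <;> linarith
    have b6 : 0 ≤ B ^ 2 * (K₂ * s) := by positivity
    have b7 : 0 ≤ B ^ 2 * (K₁ * s) := by positivity
    have b8 : 0 ≤ B * s := by positivity
    have h3 := mul_le_mul_of_nonneg_left h2 hB.le
    refine h3.trans ?_
    have eC : C * s = s + 4 * G.maxDegree * B * s + B * s + 4 * (B * (K₂ * s)) + B * (K₁ * s) +
      B ^ 2 * (K₂ * s) + 2 * (B ^ 2 * (K₁ * s)) := by rw [hC]; ring
    rw [eC]
    linarith
  · rw [div_le_iff₀ hn0]
    refine hM₂'.trans (max_le ?_ ?_)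
    · refine hs.trans ?_
      have := mul_le_mul_of_nonneg_right hC1 (by positivity : 0 ≤ n * s ^ 4)
      linarith
    · have h1 : B * n * u - B * n * z ≤ B * n * (4 * K₂ * s ^ 4) := by
        rw [← mul_sub]; gcongr
      have h2 : 0 ≤ (C - 4 * B * K₂) * (n * s ^ 4) := by
        refine mul_nonneg ?_ (by positivity)
        have : 0 ≤ 1 + 4 * G.maxDegree * B + B + B * K₁ + B ^ 2 * K₂ + 2 * B ^ 2 * K₁ := by
          positivity
        rw [hC]; linarith
      linarith

end Regimes

/-! ### Orders of growth of the error terms -/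

section Asymptotics

theorem rpow_isLittleO_rpow {r q : ℝ} (h : r < q) :
    (fun x : ℝ => x ^ r) =o[atTop] fun x => x ^ q := by
  refine isLittleO_of_tendsto' ?_ ?_
  · filter_upwards [eventually_gt_atTop 0] with x hx h0
    exact absurd h0 (Real.rpow_pos_of_pos hx q).ne'
  · refine (tendsto_rpow_neg_atTop (sub_pos.2 h)).congr' ?_
    filter_upwards [eventually_gt_atTop 0] with x hx
    rw [neg_sub, Real.rpow_sub hx]

theorem const_isLittleO_rpow (c : ℝ) {q : ℝ} (h : 0 < q) :
    (fun _ : ℝ => c) =o[atTop] fun x => x ^ q := by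
  have := (rpow_isLittleO_rpow h).const_mul_left c
  simpa using this

theorem sqrt_mul_log_isLittleO_rpow {q : ℝ} (h : 1 / 2 < q) :
    (fun x : ℝ => √x * Real.log x) =o[atTop] fun x => x ^ q := by
  have h1 := (isBigO_refl (fun x : ℝ => √x) atTop).mul_isLittleO
    (isLittleO_log_rpow_atTop (sub_pos.2 h))
  refine h1.trans_eventuallyEq ?_
  filter_upwards [eventually_gt_atTop 0] with x hx
  rw [Real.sqrt_eq_rpow, ← Real.rpow_add hx]
  congr 1
  ring

theorem entropyErr_isLittleO (b B : ℝ) {q : ℝ} (h : 1 / 2 < q) :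
    entropyErr b B =o[atTop] fun x => x ^ q := by
  have h1 := const_isLittleO_rpow 1 (by linarith : 0 < q)
  have h2 := (sqrt_mul_log_isLittleO_rpow h).const_mul_left (2 * B)
  have h3 := (rpow_isLittleO_rpow h).const_mul_left (b * B + b * B ^ 3)
  refine ((h1.add h2).add h3).congr_left fun x => ?_
  rw [entropyErr, ← Real.sqrt_eq_rpow]
  ring

theorem gradBound_isLittleO (D : ℕ) (B : ℝ) {p q : ℝ} (h : 2 * p < q) :
    gradBound D B p =o[atTop] fun x => x ^ q :=
  (rpow_isLittleO_rpow h).const_mul_left (4 * D * B)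

theorem eventually_natCast_le_of_isLittleO {F K : ℝ → ℝ} (h : F =o[atTop] K)
    (hK : ∀ x, 0 ≤ x → 0 ≤ K x) {c : ℝ} (hc : 0 < c) : ∀ᶠ n : ℕ in atTop, F n ≤ c * K n := by
  have h1 := (tendsto_natCast_atTop_atTop (R := ℝ)).eventually (h.def hc)
  filter_upwards [h1] with n hn
  rw [Real.norm_of_nonneg (hK n (Nat.cast_nonneg n))] at hn
  exact (Real.le_norm_self _).trans hn

theorem eventually_mul_sqrt_le (B : ℝ) : ∀ᶠ n : ℕ in atTop, B * √(n : ℝ) ≤ (n : ℝ) / 2 := by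
  have h := (rpow_isLittleO_rpow (show (1 / 2 : ℝ) < 1 by norm_num)).const_mul_left B
  filter_upwards [eventually_natCast_le_of_isLittleO h (fun x hx => Real.rpow_nonneg hx _)
    (show (0 : ℝ) < 1 / 2 by norm_num)] with n hn
  rw [Real.sqrt_eq_rpow]
  simp only [Real.rpow_one] at hn
  linarith

theorem sq_rpow_eventuallyEq (q : ℝ) :
    (fun x : ℝ => x ^ (2 * q - 1)) =ᶠ[atTop] fun x => (x ^ q) ^ 2 / x := by
  filter_upwards [eventually_gt_atTop 0] with x hx
  rw [Real.rpow_sub hx, Real.rpow_one, mul_comm, Real.rpow_mul hx.le, Real.rpow_two]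

theorem eventually_mul_mul_sqrt_le (B : ℝ) {q : ℝ} (hq : 3 / 4 < q) :
    ∀ᶠ n : ℕ in atTop, B * (n : ℝ) * √(n : ℝ) ≤ ((n : ℝ) ^ q) ^ 2 / 2 := by
  have h := (rpow_isLittleO_rpow (show (3 / 2 : ℝ) < 2 * q by linarith)).const_mul_left B
  filter_upwards [eventually_natCast_le_of_isLittleO h (fun x hx => Real.rpow_nonneg hx _)
    (show (0 : ℝ) < 1 / 2 by norm_num), eventually_gt_atTop 0] with n hn hn0
  have hn0' : (0 : ℝ) < n := by exact_mod_cast hn0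
  have e1 : (n : ℝ) ^ (3 / 2 : ℝ) = n * √(n : ℝ) := by
    rw [Real.sqrt_eq_rpow, show (3 / 2 : ℝ) = 1 + 1 / 2 by norm_num, Real.rpow_add hn0',
      Real.rpow_one]
  have e2 : (n : ℝ) ^ (2 * q) = ((n : ℝ) ^ q) ^ 2 := by
    rw [mul_comm, Real.rpow_mul hn0'.le, Real.rpow_two]
  rw [e1, e2] at hn
  linarith

theorem eventually_gradBound_le (D : ℕ) (B : ℝ) {p q : ℝ} (h : (1 + 2 * p) / 2 < q) :
    ∀ᶠ n : ℕ in atTop, gradBound D B p n ≤ ((n : ℝ) ^ q) ^ 2 / n := by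
  have h1 := (gradBound_isLittleO D B (show 2 * p < 2 * q - 1 by linarith)).trans_eventuallyEq
    (sq_rpow_eventuallyEq q)
  filter_upwards [eventually_natCast_le_of_isLittleO h1 (fun x hx => by positivity) one_pos]
    with n hn
  linarith

theorem eventually_mul_rpow_neg_le (K : ℝ) {r c : ℝ} (hr : 0 < r) (hc : 0 < c) :
    ∀ᶠ n : ℕ in atTop, K * (n : ℝ) ^ (-r) ≤ c := by
  have h := (((tendsto_rpow_neg_atTop hr).const_mul K).comp
    (tendsto_natCast_atTop_atTop (R := ℝ)))
  rw [mul_zero] at h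
  exact (h.eventually (eventually_lt_nhds hc)).mono fun n hn => le_of_lt hn

end Asymptotics

/-! ### Concentration for large graphs -/

section Assembly

theorem exists_eventually_gibbs_real_ge {β B p q g κ : ℝ} (D : ℕ) (hB : 0 < B) (hκ : 0 < κ)
    (hg : 0 ≤ g) (hp : 2 * p < q) (hq : 1 / 2 < q)
    (hrate : ∀ u, 0 ≤ u → u < 1 → rate (max β 0 * B ^ 2) u ≤ g) {ζ : ℝ → ℝ}
    (hζ : ζ =o[atTop] fun x => x ^ q)
    (hZ : ∀ᶠ n : ℕ in atTop, ∀ (V : Type u) [Fintype V] [Nonempty V] [DecidableEq V]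
      (G : SimpleGraph V) [DecidableRel G.Adj], G.maxDegree = D → Fintype.card V = n →
      ENNReal.ofReal (ballVolume n (B * n) * Real.exp (n * g - ζ n)) ≤
        partitionFn G (spacing V p) β B) :
    ∃ c > 0, ∀ᶠ n : ℕ in atTop, ∀ (V : Type u) [Fintype V] [Nonempty V] [DecidableEq V]
      (G : SimpleGraph V) [DecidableRel G.Adj], G.maxDegree = D → Fintype.card V = n →
      ∀ A : Set (V → ℂ),
        (∀ f, power f ≤ B * n → Typical (max β 0) B g κ ((n : ℝ) ^ q) f → f ∈ A) →
        1 - Real.exp (-(c * (n : ℝ) ^ q)) ≤ (gibbs G (spacing V p) β B).real A := by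
  have hm : 0 < min κ B⁻¹ := lt_min hκ (inv_pos.2 hB)
  have hF : (fun x => ζ x + |β| * gradBound D B p x + entropyErr (max β 0) B x + Real.log 2)
      =o[atTop] fun x => x ^ q :=
    ((hζ.add ((gradBound_isLittleO D B hp).const_mul_left |β|)).add
      (entropyErr_isLittleO _ B hq)).add (const_isLittleO_rpow _ (by linarith))
  refine ⟨min κ B⁻¹ / 4, by positivity, ?_⟩
  filter_upwards [hZ, eventually_mul_sqrt_le B, eventually_natCast_le_of_isLittleO hF
    (fun x hx => Real.rpow_nonneg hx _) (show 0 < min κ B⁻¹ / 4 by positivity)] with n h1 h2 h3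
  intro V _ _ _ G _ hD hcard A hA
  have h4 := h1 V G hD hcard
  subst hcard
  have h5 := gibbs_real_ge (G := G) (p := p) (β := β) hB hg hκ.le
    (Real.rpow_nonneg (Nat.cast_nonneg _) q) h2 hrate h4 hA
  refine le_trans ?_ h5
  have h6 : 2 * Real.exp (ζ (Fintype.card V) + |β| * gradBound G.maxDegree B p (Fintype.card V) +
      entropyErr (max β 0) B (Fintype.card V) - min κ B⁻¹ * (Fintype.card V : ℝ) ^ q / 2) ≤
      Real.exp (-(min κ B⁻¹ / 4 * (Fintype.card V : ℝ) ^ q)) := by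
    nth_rewrite 1 [← Real.exp_log (two_pos (α := ℝ))]
    rw [← Real.exp_add, hD]
    apply Real.exp_le_exp.2
    linarith
  linarith

theorem eventually_partitionFn_ge_spread {B p q : ℝ} (β : ℝ) (D : ℕ) (hB : 0 < B)
    (hq : 3 / 4 < q) :
    ∀ᶠ n : ℕ in atTop, ∀ (V : Type u) [Fintype V] [Nonempty V] [DecidableEq V]
      (G : SimpleGraph V) [DecidableRel G.Adj], G.maxDegree = D → Fintype.card V = n →
      ENNReal.ofReal (ballVolume n (B * n) * Real.exp (n * 0 -
        (|β| * (((n : ℝ) ^ q) ^ 2 / n) + |β| * gradBound D B p n + Real.log 2))) ≤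
        partitionFn G (spacing V p) β B := by
  have hF : (fun x => entropyErr 0 B x + Real.log 2) =o[atTop] fun x : ℝ => x ^ q :=
    (entropyErr_isLittleO 0 B (by linarith)).add (const_isLittleO_rpow _ (by linarith))
  filter_upwards [eventually_mul_sqrt_le B, eventually_mul_mul_sqrt_le B hq,
    eventually_natCast_le_of_isLittleO hF (fun x hx => Real.rpow_nonneg hx _)
      (show 0 < 1 / (4 * B) by positivity)] with n h1 h2 h3
  intro V _ _ _ G _ hD hcard
  subst hcard
  rw [mul_zero, zero_sub, ← hD]
  refine partitionFn_ge_spread p β hB (Real.rpow_nonneg (Nat.cast_nonneg _) q) h1 h2 ?_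
  rw [div_eq_mul_one_div, mul_comm _ (1 / (4 * B))]
  linarith

theorem spread_isLittleO (β B : ℝ) (D : ℕ) {p q : ℝ} (hp : 2 * p < q) (hq0 : 0 < q)
    (hq : q < 1) :
    (fun x : ℝ => |β| * ((x ^ q) ^ 2 / x) + |β| * gradBound D B p x + Real.log 2) =o[atTop]
      fun x => x ^ q := by
  have h1 := (sq_rpow_eventuallyEq q).symm.trans_isLittleO
    (rpow_isLittleO_rpow (show 2 * q - 1 < q by linarith))
  exact ((h1.const_mul_left |β|).add ((gradBound_isLittleO D B hp).const_mul_left |β|)).add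
    (const_isLittleO_rpow _ hq0)

theorem eventually_partitionFn_ge_condensed {B β p : ℝ} (D : ℕ) (hB : 0 < B)
    (hθ : 2 < β * B ^ 2) :
    ∀ᶠ n : ℕ in atTop, ∀ (V : Type u) [Fintype V] [Nonempty V] [DecidableEq V]
      (G : SimpleGraph V) [DecidableRel G.Adj], G.maxDegree = D → Fintype.card V = n →
      ENNReal.ofReal (ballVolume n (B * n) *
        Real.exp (n * rate (β * B ^ 2) (optFrac (β * B ^ 2)) -
          (2 * β * (B * optFrac (β * B ^ 2)) + |β| * gradBound D B p n + Real.log B))) ≤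
        partitionFn G (spacing V p) β B := by
  have hw := half_lt_optFrac hθ
  have hw1 := optFrac_lt_one hθ.le
  set w := optFrac (β * B ^ 2)
  have hβ : 0 ≤ β := by
    by_contra! h
    nlinarith [mul_nonneg (neg_nonneg.2 h.le) (sq_nonneg B)]
  have ha : 0 < B * w := mul_pos hB (by linarith)
  have h1 : ∀ᶠ n : ℕ in atTop, 1 / (B * w) ≤ (n : ℝ) :=
    (tendsto_natCast_atTop_atTop (R := ℝ)).eventually_ge_atTop _
  filter_upwards [h1] with n hn
  intro V _ _ _ G _ hD hcard
  subst hcard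
  rw [div_le_iff₀' ha] at hn
  have h := partitionFn_ge_condensed (G := G) p hβ ha (mul_lt_of_lt_one_right hB hw1) hn
  have e : rate (β * B ^ 2) w = β * (B * w) ^ 2 + Real.log (1 - B * w / B) := by
    rw [mul_div_cancel_left₀ _ hB.ne', rate]
    ring
  rw [e, ← hD]
  exact h

/-- The bounds on `u - w` and `u ^ 2 - v` separately, from a bound on the sum of their deficits. -/
theorem near_of_deficit {c θ κ s u v w : ℝ} (hc : 0 < c) (hθ : 0 < θ) (hκ : 0 ≤ κ) (hs : 0 ≤ s)
    (hv : v ≤ u ^ 2) (h : c * (u - w) ^ 2 + θ * (u ^ 2 - v) ≤ κ * s ^ 2) :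
    |u - w| ≤ √(κ / c) * s ∧ u ^ 2 - v ≤ κ / θ * s ^ 2 := by
  have h1 : 0 ≤ c * (u - w) ^ 2 := by positivity
  have h2 : 0 ≤ θ * (u ^ 2 - v) := mul_nonneg hθ.le (by linarith)
  constructor
  · refine abs_le_of_sq_le_sq ?_ (by positivity)
    rw [mul_pow, Real.sq_sqrt (by positivity), div_mul_eq_mul_div, le_div_iff₀ hc]
    linarith
  · rw [div_mul_eq_mul_div, le_div_iff₀ hθ]
    linarith

theorem Localized.mono {V : Type*} [Fintype V] [DecidableEq V] {G : SimpleGraph V}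
    [DecidableRel G.Adj] {h β B q C C' : ℝ} (hC : C ≤ C') {f : V → ℂ}
    (hf : Localized G h β B q C f) : Localized G h β B q C' f := by
  have hm : ∀ r : ℝ, C * (Fintype.card V : ℝ) ^ r ≤ C' * (Fintype.card V : ℝ) ^ r := fun r =>
    mul_le_mul_of_nonneg_right hC (Real.rpow_nonneg (Nat.cast_nonneg _) r)
  exact ⟨hf.1.trans (hm _), hf.2.1.trans (hm _), hf.2.2.1.trans (hm _), hf.2.2.2.trans (hm _)⟩

/-- One constant `C` serves as lower bound for `n`, in the exponent of the probability, and in the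
rates of the event. -/
theorem exists_const_of_eventually {β B p q : ℝ} {D : ℕ} (C₀ : ℝ)
    (S : ℝ → ∀ (V : Type u) [Fintype V] [DecidableEq V] (G : SimpleGraph V)
      [DecidableRel G.Adj], Set (V → ℂ))
    (hS : ∀ C C', C ≤ C' → ∀ (V : Type u) [Fintype V] [DecidableEq V] (G : SimpleGraph V)
      [DecidableRel G.Adj], S C V G ⊆ S C' V G)
    (h : ∃ c > 0, ∀ᶠ n : ℕ in atTop, ∀ (V : Type u) [Fintype V] [Nonempty V] [DecidableEq V]
      (G : SimpleGraph V) [DecidableRel G.Adj], G.maxDegree = D → Fintype.card V = n →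
        1 - Real.exp (-(c * (n : ℝ) ^ q)) ≤ (gibbs G (spacing V p) β B).real (S C₀ V G)) :
    ∃ C : ℝ, 0 < C ∧ ∀ (V : Type u) [Fintype V] [DecidableEq V] (G : SimpleGraph V)
      [DecidableRel G.Adj], G.maxDegree = D → C < (Fintype.card V : ℝ) →
        1 - Real.exp (-((Fintype.card V : ℝ) ^ q / C)) ≤
          (gibbs G (spacing V p) β B).real (S C V G) := by
  obtain ⟨c, hc, h⟩ := h
  obtain ⟨N, hN⟩ := eventually_atTop.1 h
  set C := max (max (N : ℝ) (1 / c)) (max C₀ 1) with hC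
  have hC1 : 1 ≤ C := (le_max_right C₀ 1).trans (le_max_right _ _)
  refine ⟨C, by linarith, fun V _ _ G _ hD hn => ?_⟩
  have hNV : N ≤ Fintype.card V := by
    exact_mod_cast ((le_max_left _ _).trans (le_max_left _ _)).trans hn.le
  have hV : Nonempty V := by
    rw [← Fintype.card_pos_iff]
    exact_mod_cast (by linarith : (0 : ℝ) < Fintype.card V)
  have htop : gibbs G (spacing V p) β B (S C V G) ≠ ⊤ := by
    refine ne_top_of_le_ne_top ENNReal.one_ne_top ((measure_mono (Set.subset_univ _)).trans ?_)
    rw [gibbs, Measure.smul_apply, smul_eq_mul]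
    exact ENNReal.inv_mul_le_one _
  refine le_trans ?_ ((hN _ hNV V G hD rfl).trans (measureReal_mono
    (hS C₀ C ((le_max_left _ _).trans (le_max_right _ _)) V G) htop))
  have hcC : 1 / C ≤ c := by
    rw [one_div_le (by linarith) hc]
    exact (le_max_right _ _).trans (le_max_left _ _)
  have : (Fintype.card V : ℝ) ^ q / C ≤ c * (Fintype.card V : ℝ) ^ q := by
    rw [div_eq_mul_one_div, mul_comm]
    exact mul_le_mul_of_nonneg_right hcC (Real.rpow_nonneg (Nat.cast_nonneg _) q)
  have := Real.exp_le_exp.2 (neg_le_neg this)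
  linarith

end Assembly

/-! ### The three regimes of the parameter -/

section Final

theorem rpow_neg_one_sub {n : ℝ} (hn : 0 < n) (q : ℝ) : n ^ (-(1 - q)) = n ^ q / n := by
  rw [neg_sub, Real.rpow_sub hn, Real.rpow_one]

theorem exists_eventually_localized {β B p q c κ : ℝ} (D : ℕ) (hB : 0 < B) (hp : 2 * p < q)
    (hq : 1 / 2 < q) (hq1 : q < 1) (hθ : 2 < β * B ^ 2) (hc : 0 < c) (hκ : 0 ≤ κ) :
    ∃ C : ℝ, ∀ᶠ n : ℕ in atTop, ∀ (V : Type u) [Fintype V] [Nonempty V] [DecidableEq V]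
      (G : SimpleGraph V) [DecidableRel G.Adj], G.maxDegree = D → Fintype.card V = n →
      ∀ f : V → ℂ, power f ≤ B * n → B * n - (n : ℝ) ^ q < power f →
        c * (massFrac B f - optFrac (β * B ^ 2)) ^ 2 +
          β * B ^ 2 * (massFrac B f ^ 2 - quarticFrac B f) ≤ κ * ((n : ℝ) ^ q / n) →
        Localized G (spacing V p) β B q C f := by
  have hθ0 : 0 < β * B ^ 2 := by linarith
  refine ⟨1 + 4 * D * B + B + 4 * B * (κ / (β * B ^ 2)) + B * √(κ / c) +
      B ^ 2 * (κ / (β * B ^ 2)) + 2 * B ^ 2 * √(κ / c), ?_⟩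
  filter_upwards [eventually_mul_rpow_neg_le (√(κ / c)) (show 0 < (1 - q) / 2 by linarith)
    (show (0 : ℝ) < 1 / 4 by norm_num)] with n hsmall
  intro V _ _ _ G _ hD hcard f hf hlow h
  subst hcard
  have hn0 : (0 : ℝ) < Fintype.card V := by exact_mod_cast Fintype.card_pos
  have hn1 : (1 : ℝ) ≤ Fintype.card V := by exact_mod_cast Fintype.card_pos
  have hsq : ((Fintype.card V : ℝ) ^ (-(1 - q) / 2)) ^ 2 = (Fintype.card V : ℝ) ^ (-(1 - q)) := by
    rw [← Real.rpow_natCast, ← Real.rpow_mul hn0.le]; congr 1; push_cast; ring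
  rw [← rpow_neg_one_sub hn0, ← hsq] at h
  obtain ⟨h1, h2⟩ := near_of_deficit hc hθ0 hκ (Real.rpow_nonneg hn0.le _) (quarticFrac_le B f) h
  rw [hsq] at h2
  rw [← neg_div] at hsmall
  have hs : √(Fintype.card V : ℝ) ≤ (Fintype.card V : ℝ) ^ q := by
    rw [Real.sqrt_eq_rpow]
    exact Real.rpow_le_rpow_of_exponent_le hn1 hq.le
  have hG : gradBound G.maxDegree B p (Fintype.card V) ≤
      4 * G.maxDegree * B * (Fintype.card V : ℝ) ^ q := by
    unfold gradBound
    gcongr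
  rw [← hD]
  exact Localized.of_massFrac_near hB hq1 (Real.sqrt_nonneg _) (by positivity) hθ hf hlow h1 h2
    hsmall hs hG

theorem eventually_delocalized {B p q : ℝ} (D : ℕ) (hp : (1 + 2 * p) / 2 < q) (hq : 3 / 4 < q) :
    ∀ᶠ n : ℕ in atTop, ∀ (V : Type u) [Fintype V] [Nonempty V] [DecidableEq V]
      (G : SimpleGraph V) [DecidableRel G.Adj], G.maxDegree = D → Fintype.card V = n →
      ∀ f : V → ℂ, power f ≤ B * n → B * n - (n : ℝ) ^ q < power f →
        bigMass f ≤ (n : ℝ) ^ q / 2 → Delocalized G (spacing V p) B q f := by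
  filter_upwards [eventually_mul_mul_sqrt_le B hq, eventually_gradBound_le D B hp] with n h1 h2
  intro V _ _ _ G _ hD hcard f hf hlow hm
  subst hcard
  have hn1 : (1 : ℝ) ≤ Fintype.card V := by exact_mod_cast Fintype.card_pos
  have hs : √(Fintype.card V : ℝ) ≤ (Fintype.card V : ℝ) ^ q := by
    rw [Real.sqrt_eq_rpow]
    exact Real.rpow_le_rpow_of_exponent_le hn1 (by linarith)
  rw [← hD] at h2
  exact Delocalized.of_bigMass_le hf hlow hm h1 hs h2

theorem bigMass_le_of_massFrac_lt {V : Type*} [Fintype V] [Nonempty V] {B c q : ℝ} (hB : 0 < B)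
    (hc : 0 < c) {f : V → ℂ}
    (h : c * massFrac B f < c / (2 * B) * ((Fintype.card V : ℝ) ^ q / Fintype.card V)) :
    bigMass f ≤ (Fintype.card V : ℝ) ^ q / 2 := by
  have hn0 : (0 : ℝ) < Fintype.card V := by exact_mod_cast Fintype.card_pos
  rw [bigMass_eq hB]
  rw [div_mul_eq_mul_div, mul_div_assoc] at h
  have h1 := lt_of_mul_lt_mul_left h hc.le
  have h2 := mul_lt_mul_of_pos_left h1 (by positivity : 0 < B * (Fintype.card V : ℝ))
  refine h2.le.trans_eq ?_
  field_simp

theorem localized_regime {β B p q : ℝ} (D : ℕ) (hB : 0 < B) (hq1 : q < 1)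
    (hθ : thetaC < β * B ^ 2) (hp : 2 * p < q) (hq : 1 / 2 < q) :
    ∃ C : ℝ, 0 < C ∧ ∀ (V : Type u) [Fintype V] [DecidableEq V] (G : SimpleGraph V)
      [DecidableRel G.Adj], G.maxDegree = D → C < (Fintype.card V : ℝ) →
        1 - Real.exp (-((Fintype.card V : ℝ) ^ q / C)) ≤
          (gibbs G (spacing V p) β B).real {ψ | Localized G (spacing V p) β B q C ψ} := by
  have h2 : 2 < β * B ^ 2 := two_lt_thetaC.trans hθ
  obtain ⟨hpos, c, hc, hr⟩ := exists_rate_supercritical_le hθ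
  have hβ : max β 0 = β := max_eq_left (by
    by_contra! h
    nlinarith [mul_nonneg (neg_nonneg.2 h.le) (sq_nonneg B)])
  obtain ⟨C₀, hC₀⟩ := exists_eventually_localized.{u} (p := p) D hB hp hq hq1 h2 hc zero_le_one
  refine exists_const_of_eventually C₀
    (fun C V _ _ G _ => {ψ | Localized G (spacing V p) β B q C ψ})
    (fun C C' hCC' V _ _ G _ f hf => Localized.mono hCC' hf) ?_
  have hζ : (fun x : ℝ => 2 * β * (B * optFrac (β * B ^ 2)) + |β| * gradBound D B p x +
      Real.log B) =o[atTop] fun x => x ^ q :=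
    ((const_isLittleO_rpow _ (by linarith)).add
      ((gradBound_isLittleO D B hp).const_mul_left |β|)).add
      (const_isLittleO_rpow _ (by linarith))
  obtain ⟨c', hc', hev⟩ := exists_eventually_gibbs_real_ge (β := β) D hB one_pos hpos.le hp hq
    (fun u h0 h1 => by
      rw [hβ]
      have := hr u h0 h1
      have : 0 ≤ c * (u - optFrac (β * B ^ 2)) ^ 2 := by positivity
      linarith) hζ (eventually_partitionFn_ge_condensed.{u} D hB h2)
  refine ⟨c', hc', ?_⟩
  filter_upwards [hev, hC₀] with n h3 h4
  intro V _ _ _ G _ hD hcard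
  refine h3 V G hD hcard _ fun f hf hT => h4 V G hD hcard f hf ?_ ?_
  · rw [← hcard] at hT ⊢
    exact hT.1
  · obtain ⟨hu1, hu2⟩ := hT.lt_rate hB
    rw [hβ, hcard] at hu2
    have := hr _ (massFrac_nonneg hB f) hu1
    linarith

theorem delocalized_regime {β B p q : ℝ} (D : ℕ) (hB : 0 < B) (hp1 : p < 1 / 2) (hq1 : q < 1)
    (hθ : β * B ^ 2 < thetaC) (hp : (1 + 2 * p) / 2 < q) (hq : 3 / 4 < q) :
    ∃ C : ℝ, 0 < C ∧ ∀ (V : Type u) [Fintype V] [DecidableEq V] (G : SimpleGraph V)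
      [DecidableRel G.Adj], G.maxDegree = D → C < (Fintype.card V : ℝ) →
        1 - Real.exp (-((Fintype.card V : ℝ) ^ q / C)) ≤
          (gibbs G (spacing V p) β B).real {ψ | Delocalized G (spacing V p) B q ψ} := by
  have hb : max β 0 * B ^ 2 < thetaC := by
    rcases le_total β 0 with h | h
    · rw [max_eq_right h, zero_mul]; linarith [two_lt_thetaC]
    · rwa [max_eq_left h]
  obtain ⟨c, hc, hr⟩ := exists_rate_subcritical_le hb
  refine exists_const_of_eventually 0
    (fun _ V _ _ G _ => {ψ | Delocalized G (spacing V p) B q ψ})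
    (fun _ _ _ V _ _ G _ f hf => hf) ?_
  obtain ⟨c', hc', hev⟩ := exists_eventually_gibbs_real_ge (β := β) (κ := c / (2 * B)) D hB
    (by positivity) le_rfl (by linarith) (by linarith)
    (fun u h0 h1 => by
      have := hr u h0 h1
      have : 0 ≤ c * u := by positivity
      linarith) (spread_isLittleO β B D (by linarith) (by linarith) hq1)
    (eventually_partitionFn_ge_spread.{u} (p := p) β D hB hq)
  refine ⟨c', hc', ?_⟩
  filter_upwards [hev, eventually_delocalized.{u} (B := B) D hp hq] with n h3 h4
  intro V _ _ _ G _ hD hcard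
  refine h3 V G hD hcard _ fun f hf hT => h4 V G hD hcard f hf ?_ ?_
  · rw [← hcard] at hT ⊢
    exact hT.1
  · obtain ⟨hu1, hu2⟩ := hT.lt_rate hB
    rw [← hcard] at hu2 ⊢
    have h5 := hr _ (massFrac_nonneg hB f) hu1
    have h6 : 0 ≤ max β 0 * B ^ 2 * (massFrac B f ^ 2 - quarticFrac B f) :=
      mul_nonneg (mul_nonneg (le_max_right _ _) (sq_nonneg B))
        (sub_nonneg.2 (quarticFrac_le B f))
    exact bigMass_le_of_massFrac_lt hB hc (by linarith)

theorem critical_regime {β B p q : ℝ} (D : ℕ) (hB : 0 < B) (hp1 : p < 1 / 2) (hq1 : q < 1)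
    (hθ : β * B ^ 2 = thetaC) (hp : (1 + 2 * p) / 2 < q) (hq : 3 / 4 < q) :
    ∃ C : ℝ, 0 < C ∧ ∀ (V : Type u) [Fintype V] [DecidableEq V] (G : SimpleGraph V)
      [DecidableRel G.Adj], G.maxDegree = D → C < (Fintype.card V : ℝ) →
        1 - Real.exp (-((Fintype.card V : ℝ) ^ q / C)) ≤
          (gibbs G (spacing V p) β B).real {ψ | Localized G (spacing V p) β B q C ψ ∨
            Delocalized G (spacing V p) B q ψ} := by
  have h2 : 2 < β * B ^ 2 := two_lt_thetaC.trans_eq hθ.symm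
  obtain ⟨c, hc, hr⟩ := exists_rate_critical_le
  rw [← hθ] at hr
  have hβ : max β 0 = β := max_eq_left (by
    by_contra! h
    nlinarith [mul_nonneg (neg_nonneg.2 h.le) (sq_nonneg B)])
  have hκ : 0 < c / (2 * B) := by positivity
  obtain ⟨C₀, hC₀⟩ := exists_eventually_localized.{u} (p := p) (q := q) D hB (by linarith)
    (by linarith) hq1 h2 hc hκ.le
  refine exists_const_of_eventually C₀
    (fun C V _ _ G _ => {ψ | Localized G (spacing V p) β B q C ψ ∨
            Delocalized G (spacing V p) B q ψ})
    (fun C C' hCC' V _ _ G _ f hf => hf.imp_left (Localized.mono hCC')) ?_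
  obtain ⟨c', hc', hev⟩ := exists_eventually_gibbs_real_ge (β := β) (κ := c / (2 * B)) D hB
    hκ le_rfl (by linarith) (by linarith)
    (fun u h0 h1 => by
      rw [hβ]
      have := hr u h0 h1
      have : 0 ≤ c * min u ((u - optFrac (β * B ^ 2)) ^ 2) :=
        mul_nonneg hc.le (le_min h0 (sq_nonneg _))
      linarith) (spread_isLittleO β B D (by linarith) (by linarith) hq1)
    (eventually_partitionFn_ge_spread.{u} (p := p) β D hB hq)
  refine ⟨c', hc', ?_⟩
  filter_upwards [hev, hC₀, eventually_delocalized.{u} (B := B) D hp hq] with n h3 h4 h5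
  intro V _ _ _ G _ hD hcard
  refine h3 V G hD hcard _ fun f hf hT => ?_
  obtain ⟨hu1, hu2⟩ := hT.lt_rate hB
  have hlow := hT.1
  rw [hβ, hcard] at hu2
  rw [hcard] at hlow
  have h6 := hr _ (massFrac_nonneg hB f) hu1
  have h7 : 0 ≤ β * B ^ 2 * (massFrac B f ^ 2 - quarticFrac B f) :=
    mul_nonneg (by linarith) (sub_nonneg.2 (quarticFrac_le B f))
  rcases le_total (massFrac B f) ((massFrac B f - optFrac (β * B ^ 2)) ^ 2) with h | h
  · right
    rw [min_eq_left h] at h6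
    refine h5 V G hD hcard f hf hlow ?_
    rw [← hcard] at hu2 ⊢
    exact bigMass_le_of_massFrac_lt hB hc (by linarith)
  · left
    rw [min_eq_right h] at h6
    exact h4 V G hD hcard f hf hlow (by linarith)

end Final
end DNLS
theorem theorem2p2 (β B p q : ℝ) (D : ℕ) (hB : 0 < B) (hp₀ : 0 < p) (hp : p < 1 / 2)
    (hq : q < 1) :
    (DNLS.thetaC < β * B ^ 2 → max (2 * p) (4 / 5) < q →
      ∃ C : ℝ, 0 < C ∧
        ∀ (V : Type u) [Fintype V] [DecidableEq V] (G : SimpleGraph V) [DecidableRel G.Adj],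
          G.maxDegree = D → C < (Fintype.card V : ℝ) →
          1 - Real.exp (-((Fintype.card V : ℝ) ^ q / C)) ≤
            (DNLS.gibbs G (DNLS.spacing V p) β B).real
              {ψ | DNLS.Localized G (DNLS.spacing V p) β B q C ψ}) ∧
    (β * B ^ 2 < DNLS.thetaC → max ((1 + 2 * p) / 2) (17 / 18) < q →
      ∃ C : ℝ, 0 < C ∧
        ∀ (V : Type u) [Fintype V] [DecidableEq V] (G : SimpleGraph V) [DecidableRel G.Adj],
          G.maxDegree = D → C < (Fintype.card V : ℝ) →
          1 - Real.exp (-((Fintype.card V : ℝ) ^ q / C)) ≤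
            (DNLS.gibbs G (DNLS.spacing V p) β B).real
              {ψ | DNLS.Delocalized G (DNLS.spacing V p) B q ψ}) ∧
    (β * B ^ 2 = DNLS.thetaC → max ((1 + 2 * p) / 2) (17 / 18) < q →
      ∃ C : ℝ, 0 < C ∧
        ∀ (V : Type u) [Fintype V] [DecidableEq V] (G : SimpleGraph V) [DecidableRel G.Adj],
          G.maxDegree = D → C < (Fintype.card V : ℝ) →
          1 - Real.exp (-((Fintype.card V : ℝ) ^ q / C)) ≤
            (DNLS.gibbs G (DNLS.spacing V p) β B).real
              {ψ | DNLS.Localized G (DNLS.spacing V p) β B q C ψ ∨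
                DNLS.Delocalized G (DNLS.spacing V p) B q ψ}) := by
  refine ⟨fun hθ hm => ?_, fun hθ hm => ?_, fun hθ hm => ?_⟩
  · obtain ⟨h1, h2⟩ := max_lt_iff.1 hm
    exact DNLS.localized_regime D hB hq hθ h1 (by linarith)
  · obtain ⟨h1, h2⟩ := max_lt_iff.1 hm
    exact DNLS.delocalized_regime D hB hp hq hθ h1 (by linarith)
  · obtain ⟨h1, h2⟩ := max_lt_iff.1 hm
    exact DNLS.critical_regime D hB hp hq hθ h1 (by linarith)
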